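/- Let $R$ be a prime (left and right) Goldie ring with classical (left and right) quotient ring $Q$, write $A^\bullet = A\cap Q^\times$ for $A\subseteq Q$, and let $H=R^\bullet$ be the monoid of regular elements of $R$, with quotient group $\mathsf q(H)=Q^\times$. Definitions. A fractional ideal of $R$ is a left and right $R$-submodule $\mathfrak a$ of $Q$ with $a\mathfrak a\subseteq R$ and $\mathfrak a b\subseteq R$ for some $a,b\in Q^\times$. For a submonoid $S$ of a group $G$ such that every element of $G$ has the form $a^{-1}b$ and also the form $ba^{-1}$ with $a,b\in S$ (so $G=\mathsf q(S)$), a fractional ideal of $S$ is a (possibly empty) subset $\mathfrak a\subseteq G$ with $S\mathfrak a=\mathfrak a=\mathfrak aS$ and $\mathfrak a a\subseteq S$, $b\mathfrak a\subseteq S$ for some $a,b\in S$. Ideals are two-sided: they are the fractional ideals contained in $R$ (in $S$). An ideal $\mathfrak p\neq R$ (resp. $\mathfrak p\ne S$) is prime if, for all ideals $\mathfrak a,\mathfrak b$, $\mathfrak a\mathfrak b\subseteq\mathfrak p$ implies $\mathfrak a\subseteq\mathfrak p$ or $\mathfrak b\subseteq\mathfrak p$. Put $(A:_lB)=\{x: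 xB\subseteq A\}$ and $(A:_rB)=\{x: Bx\subseteq A\}$, where $x$ ranges over $Q$ (resp. $G$). With $X=R$ or $X=S$: if $(X:_l(X:_r\mathfrak a))=(X:_r(X:_l\mathfrak a))$, we say that $\mathfrak a_v$ is defined and let $\mathfrak a_v$ be this set; a fractional ideal $\mathfrak a$ is divisorial if $\mathfrak a_v$ is defined and $\mathfrak a=\mathfrak a_v$. Let $\mathcal F_v(X)$, $\mathcal I_v(X)$, $v\text{-spec}(X)$ denote the sets of divisorial fractional ideals, divisorial ideals and divisorial prime ideals, and put $\mathfrak a\cdot_v\mathfrak b=(\mathfrak a\mathfrak b)_v$ if this is defined. $X$ is completely integrally closed if $(\mathfrak a:_l\mathfrak a)=(\mathfrak a:_r\mathfrak a)=X$ for all non-zero (resp. non-empty) ideals $\mathfrak a$ of $X$. A prime Goldie ring (resp. a monoid $S$ as above) is a Krull ring (resp. Krull monoid) if it is completely integrally closed and satisfies the ascending chain condition on divisorial ideals. For a subset $\mathfrak a\subseteq Q^\times$, $\langle\mathfrak a\rangle_R$ is the right $R$-submodule of $Q$ generated by $\mathfrak a$. Finally $\mathsf N(H)=\{a\in H: aH=Ha\}$,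 and a monoid $S$ is normalizing if $aS=Sa$ for all $a\in S$. Proposition. 1. $R$ is completely integrally closed if and only if $H$ is completely integrally closed. 2. The maps $\iota^\bullet:\mathcal F_v(R)\to\mathcal F_v(H)$, $\mathfrak a\mapsto\mathfrak a^\bullet$, and $\iota^\circ:\mathcal F_v(H)\to\mathcal F_v(R)$, $\mathfrak a\mapsto\langle\mathfrak a\rangle_R$, are well defined, inclusion preserving and inverse to each other, and they are isomorphisms with respect to $v$-multiplication: for $\mathfrak a,\mathfrak b\in\mathcal F_v(R)$, $\mathfrak a\cdot_v\mathfrak b$ is defined if and only if $\mathfrak a^\bullet\cdot_v\mathfrak b^\bullet$ is, and then both products are again divisorial fractional ideals and $(\mathfrak a\cdot_v\mathfrak b)^\bullet=\mathfrak a^\bullet\cdot_v\mathfrak b^\bullet$; likewise $\langle\mathfrak a\cdot_v\mathfrak b\rangle_R=\langle\mathfrak a\rangle_R\cdot_v\langle\mathfrak b\rangle_R$ for $\mathfrak a,\mathfrak b\in\mathcal F_v(H)$ whenever $\mathfrak a\cdot_v\mathfrak b$ is defined. If $R$ is completely integrally closed, all these products are defined. Furthermore: (a) $\iota^\bullet$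 restricts to bijections $\mathcal I_v(R)\to\mathcal I_v(H)$ and $v\text{-spec}(R)\to v\text{-spec}(H)$; (b) $R$ satisfies the ascending chain condition on divisorial ideals if and only if $H$ does. 3. $R$ is a Krull ring if and only if $H$ is a Krull monoid, and if this holds, then $\mathsf N(H)$ (with the subgroup of $Q^\times$ that it generates as its quotient group) is a normalizing Krull monoid. -/

import Mathlib

open scoped Pointwise

/-! # Divisorial ideals of a monoid inside its quotient group -/

namespace KrullMonoid

variable {G : Type*} [Group G]

/-- `G` is a (left and right) quotient group of its submonoid `H`: every element of `G` has the form
`a⁻¹ b` and also the form `b a⁻¹` with `a, b ∈ H`.  A cancellative semigroup has such a group if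
and only if it satisfies both Ore conditions. -/
def IsQuotientGroup (H : Submonoid G) : Prop :=
  (∀ g : G, ∃ a ∈ H, ∃ b ∈ H, g = a⁻¹ * b) ∧ (∀ g : G, ∃ a ∈ H, ∃ b ∈ H, g = b * a⁻¹)

/-- The left quotient `(A :ₗ B) = {x | x B ⊆ A}`. -/
def leftQuot (A B : Set G) : Set G := {x | ∀ b ∈ B, x * b ∈ A}

/-- The right quotient `(A :ᵣ B) = {x | B x ⊆ A}`. -/
def rightQuot (A B : Set G) : Set G := {x | ∀ b ∈ B, b * x ∈ A}

/-- `A` is a fractional ideal of `H`: `HA = A = AH`, and `A a ⊆ H`, `b A ⊆ H` for some `a, b ∈ H`.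
The empty set is one. -/
def IsFractionalIdeal (H : Submonoid G) (A : Set G) : Prop :=
  (H : Set G) * A = A ∧ A * (H : Set G) = A ∧
    (∃ a ∈ H, ∀ x ∈ A, x * a ∈ H) ∧ (∃ b ∈ H, ∀ x ∈ A, b * x ∈ H)

/-- Two-sided ideals of `H`: the fractional ideals contained in `H`. -/
def IsIdeal (H : Submonoid G) (A : Set G) : Prop :=
  IsFractionalIdeal H A ∧ A ⊆ (H : Set G)

/-- `(H :ₗ (H :ᵣ A))`. -/
def leftClosure (H : Submonoid G) (A : Set G) : Set G := leftQuot H (rightQuot H A)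

/-- `(H :ᵣ (H :ₗ A))`. -/
def rightClosure (H : Submonoid G) (A : Set G) : Set G := rightQuot H (leftQuot H A)

/-- The set `A_v` is defined, i.e. `(H :ₗ (H :ᵣ A)) = (H :ᵣ (H :ₗ A))`. -/
def HasVClosure (H : Submonoid G) (A : Set G) : Prop := leftClosure H A = rightClosure H A

/-- `A_v`; meaningful when `HasVClosure H A` holds. -/
def vClosure (H : Submonoid G) (A : Set G) : Set G := leftClosure H A

/-- The divisorial fractional ideals `F_v(H)`. -/
def divFrac (H : Submonoid G) : Set (Set G) :=
  {A | IsFractionalIdeal H A ∧ HasVClosure H A ∧ A = vClosure H A}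

/-- The divisorial ideals `I_v(H)`. -/
def divIdeals (H : Submonoid G) : Set (Set G) := {A | A ∈ divFrac H ∧ IsIdeal H A}

/-- Prime ideals of `H`. -/
def IsPrimeIdeal (H : Submonoid G) (P : Set G) : Prop :=
  IsIdeal H P ∧ P ≠ (H : Set G) ∧
    ∀ A B : Set G, IsIdeal H A → IsIdeal H B → A * B ⊆ P → A ⊆ P ∨ B ⊆ P

/-- The divisorial prime ideals `v-spec(H)`. -/
def vSpec (H : Submonoid G) : Set (Set G) := {P | IsPrimeIdeal H P ∧ P ∈ divIdeals H}

/-- `H` is completely integrally closed: `(A :ₗ A) = (A :ᵣ A) = H` for all non-empty ideals `A`. -/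
def IsComplIntClosed (H : Submonoid G) : Prop :=
  ∀ A : Set G, IsIdeal H A → A.Nonempty → leftQuot A A = H ∧ rightQuot A A = H

/-- The ascending chain condition on divisorial ideals of `H`. -/
def IsVNoetherian (H : Submonoid G) : Prop :=
  ∀ A : ℕ → Set G, (∀ n, A n ∈ divIdeals H) → Monotone A → ∃ n, ∀ m, n ≤ m → A m = A n

/-- `H` is a Krull monoid with quotient group `G`. -/
def IsKrull (H : Submonoid G) : Prop :=
  IsQuotientGroup H ∧ IsComplIntClosed H ∧ IsVNoetherian H

/-- The condition `aH = Ha`. -/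
def IsNormalElt (H : Submonoid G) (a : G) : Prop :=
  ({a} : Set G) * (H : Set G) = (H : Set G) * {a}

/-- The normalizing submonoid `N(H) = {a ∈ H | aH = Ha}`. -/
def normalizingSubmonoid (H : Submonoid G) : Submonoid G where
  carrier := {a | a ∈ H ∧ IsNormalElt H a}
  one_mem' := ⟨H.one_mem, by simp [IsNormalElt]⟩
  mul_mem' := by
    rintro a b ⟨ha, ha'⟩ ⟨hb, hb'⟩
    refine ⟨H.mul_mem ha hb, ?_⟩
    unfold IsNormalElt at *
    rw [← Set.singleton_mul_singleton, mul_assoc, hb', ← mul_assoc, ha', mul_assoc]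

/-- `H` is normalizing: `aH = Ha` for all `a ∈ H`. -/
def IsNormalizing (H : Submonoid G) : Prop := ∀ a ∈ H, IsNormalElt H a

/-- The submonoid `S` of `G`, regarded inside the subgroup of `G` that it generates (which is the
quotient group of `S` whenever `S` has one). -/
def inOwnGroup (S : Submonoid G) : Submonoid (Subgroup.closure (S : Set G)) :=
  S.comap (Subgroup.closure (S : Set G)).subtype

end KrullMonoid

/-! # Prime Goldie rings and their divisorial ideals -/

namespace KrullRing

/-- The module `M` contains no infinite direct sum of non-zero submodules. -/
def HasFiniteUniformDim (A M : Type*) [Semiring A] [AddCommMonoid M] [Module A M] : Prop :=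
  ¬ ∃ N : ℕ → Submodule A M, (∀ n, N n ≠ ⊥) ∧ iSupIndep N

/-- The right annihilator of a subset. -/
def rightAnn {R : Type*} [Ring R] (S : Set R) : Set R := {x | ∀ s ∈ S, s * x = 0}

/-- The left annihilator of a subset. -/
def leftAnn {R : Type*} [Ring R] (S : Set R) : Set R := {x | ∀ s ∈ S, x * s = 0}

/-- Right Goldie rings: finite right uniform dimension, and the ascending chain condition on right
annihilators. -/
def IsRightGoldie (R : Type*) [Ring R] : Prop :=
  HasFiniteUniformDim Rᵐᵒᵖ R ∧
    ∀ S : ℕ → Set R, Monotone (fun n => rightAnn (S n)) →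
      ∃ n, ∀ m, n ≤ m → rightAnn (S m) = rightAnn (S n)

/-- Left Goldie rings. -/
def IsLeftGoldie (R : Type*) [Ring R] : Prop :=
  HasFiniteUniformDim R R ∧
    ∀ S : ℕ → Set R, Monotone (fun n => leftAnn (S n)) →
      ∃ n, ∀ m, n ≤ m → leftAnn (S m) = leftAnn (S n)

/-- Prime rings: `R ≠ 0`, and `aRb = 0` implies `a = 0` or `b = 0`. -/
def IsPrimeRing (R : Type*) [Ring R] : Prop :=
  Nontrivial R ∧ ∀ a b : R, (∀ r : R, a * r * b = 0) → a = 0 ∨ b = 0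

/-- Prime rings that are left and right Goldie. -/
def IsPrimeGoldie (R : Type*) [Ring R] : Prop :=
  IsPrimeRing R ∧ IsLeftGoldie R ∧ IsRightGoldie R

variable {Q : Type*} [Ring Q]

/-- `Q` is a classical (left and right) quotient ring of its subring `R`: every regular element of
`R` is invertible in `Q`, and every element of `Q` has the form `s⁻¹ r` and also the form `r s⁻¹`
with `r, s ∈ R` and `s` regular in `R`. -/
def IsClassicalQuotientRing (R : Subring Q) : Prop :=
  (∀ s ∈ nonZeroDivisors R, IsUnit (s : Q)) ∧
  (∀ q : Q, ∃ r : R, ∃ s ∈ nonZeroDivisors R, (s : Q) * q = r) ∧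
  (∀ q : Q, ∃ r : R, ∃ s ∈ nonZeroDivisors R, q * (s : Q) = r)

/-- The set `A^• = A ∩ Qˣ`, as a subset of the group `Qˣ`. -/
def reg (A : AddSubgroup Q) : Set Qˣ := {u | (u : Q) ∈ A}

/-- The monoid `H = R^• = R ∩ Qˣ`. If `Q` is a classical quotient ring of `R`, it is the monoid of
regular elements of `R`, see `mem_regMonoid_iff`. -/
def regMonoid (R : Subring Q) : Submonoid Qˣ := R.toSubmonoid.comap (Units.coeHom Q)

theorem mem_regMonoid_iff (R : Subring Q) (hQ : IsClassicalQuotientRing R) (x : Q) :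
    (∃ u ∈ regMonoid R, (u : Q) = x) ↔ ∃ r ∈ nonZeroDivisors R, (r : Q) = x := by
  constructor
  · rintro ⟨u, hu, rfl⟩
    refine ⟨⟨u, hu⟩, ⟨fun y hy => ?_, fun y hy => ?_⟩, rfl⟩
    · have h : (u : Q) * (y : Q) = 0 := congrArg Subtype.val hy
      exact Subtype.ext ((Units.mul_right_eq_zero u).1 h)
    · have h : (y : Q) * (u : Q) = 0 := congrArg Subtype.val hy
      exact Subtype.ext ((Units.mul_left_eq_zero u).1 h)
  · rintro ⟨r, hr, rfl⟩
    obtain ⟨u, hu⟩ := hQ.1 r hr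
    exact ⟨u, by change (u : Q) ∈ R; rw [hu]; exact r.2, hu⟩

/-- The left quotient `(A :ₗ B) = {x ∈ Q | x B ⊆ A}`. -/
def leftQuot (A B : AddSubgroup Q) : AddSubgroup Q where
  carrier := {x | ∀ b ∈ B, x * b ∈ A}
  zero_mem' := fun b _ => by simp
  add_mem' := fun hx hy b hb => by rw [add_mul]; exact A.add_mem (hx b hb) (hy b hb)
  neg_mem' := fun hx b hb => by rw [neg_mul]; exact A.neg_mem (hx b hb)

/-- The right quotient `(A :ᵣ B) = {x ∈ Q | B x ⊆ A}`. -/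
def rightQuot (A B : AddSubgroup Q) : AddSubgroup Q where
  carrier := {x | ∀ b ∈ B, b * x ∈ A}
  zero_mem' := fun b _ => by simp
  add_mem' := fun hx hy b hb => by rw [mul_add]; exact A.add_mem (hx b hb) (hy b hb)
  neg_mem' := fun hx b hb => by rw [mul_neg]; exact A.neg_mem (hx b hb)

/-- `A` is a fractional ideal of `R`: a left and right `R`-submodule of `Q` such that `a A ⊆ R` and
`A b ⊆ R` for some `a, b ∈ Qˣ`. -/
def IsFractionalIdeal (R : Subring Q) (A : AddSubgroup Q) : Prop :=
  (∀ r ∈ R, ∀ x ∈ A, r * x ∈ A) ∧ (∀ r ∈ R, ∀ x ∈ A, x * r ∈ A) ∧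
    (∃ a : Qˣ, ∀ x ∈ A, (a : Q) * x ∈ R) ∧ (∃ b : Qˣ, ∀ x ∈ A, x * (b : Q) ∈ R)

/-- Two-sided ideals of `R`, as subsets of `Q` (a left and right submodule contained in `R`). -/
def IsIdeal (R : Subring Q) (A : AddSubgroup Q) : Prop :=
  (∀ r ∈ R, ∀ x ∈ A, r * x ∈ A) ∧ (∀ r ∈ R, ∀ x ∈ A, x * r ∈ A) ∧ A ≤ R.toAddSubgroup

/-- `(R :ₗ (R :ᵣ A))`. -/
def leftClosure (R : Subring Q) (A : AddSubgroup Q) : AddSubgroup Q :=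
  leftQuot R.toAddSubgroup (rightQuot R.toAddSubgroup A)

/-- `(R :ᵣ (R :ₗ A))`. -/
def rightClosure (R : Subring Q) (A : AddSubgroup Q) : AddSubgroup Q :=
  rightQuot R.toAddSubgroup (leftQuot R.toAddSubgroup A)

/-- `A_v` is defined, i.e. `(R :ₗ (R :ᵣ A)) = (R :ᵣ (R :ₗ A))`. -/
def HasVClosure (R : Subring Q) (A : AddSubgroup Q) : Prop := leftClosure R A = rightClosure R A

/-- `A_v`; meaningful when `HasVClosure R A` holds. -/
def vClosure (R : Subring Q) (A : AddSubgroup Q) : AddSubgroup Q := leftClosure R A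

/-- The divisorial fractional ideals `F_v(R)`. -/
def divFrac (R : Subring Q) : Set (AddSubgroup Q) :=
  {A | IsFractionalIdeal R A ∧ HasVClosure R A ∧ A = vClosure R A}

/-- The divisorial ideals `I_v(R)`. -/
def divIdeals (R : Subring Q) : Set (AddSubgroup Q) := {A | A ∈ divFrac R ∧ IsIdeal R A}

/-- Prime ideals of `R`. -/
def IsPrimeIdeal (R : Subring Q) (P : AddSubgroup Q) : Prop :=
  IsIdeal R P ∧ P ≠ R.toAddSubgroup ∧
    ∀ A B : AddSubgroup Q, IsIdeal R A → IsIdeal R B → A * B ≤ P → A ≤ P ∨ B ≤ P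

/-- The divisorial prime ideals `v-spec(R)`. -/
def vSpec (R : Subring Q) : Set (AddSubgroup Q) := {P | IsPrimeIdeal R P ∧ P ∈ divIdeals R}

/-- `R` is completely integrally closed: `(A :ₗ A) = (A :ᵣ A) = R` for all non-zero ideals `A`. -/
def IsComplIntClosed (R : Subring Q) : Prop :=
  ∀ A : AddSubgroup Q, IsIdeal R A → A ≠ ⊥ →
    leftQuot A A = R.toAddSubgroup ∧ rightQuot A A = R.toAddSubgroup

/-- The ascending chain condition on divisorial ideals of `R`. -/
def IsVNoetherian (R : Subring Q) : Prop :=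
  ∀ A : ℕ → AddSubgroup Q, (∀ n, A n ∈ divIdeals R) → Monotone A → ∃ n, ∀ m, n ≤ m → A m = A n

/-- `R` is a Krull ring (with classical quotient ring `Q`). -/
def IsKrull (R : Subring Q) : Prop :=
  IsPrimeGoldie R ∧ IsComplIntClosed R ∧ IsVNoetherian R

/-- The right `R`-submodule `⟨X⟩_R` of `Q` generated by `X ⊆ Qˣ`. -/
def span (R : Subring Q) (X : Set Qˣ) : AddSubgroup Q :=
  AddSubgroup.closure {y | ∃ x ∈ X, ∃ r ∈ R, y = (x : Q) * r}

end KrullRing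

/-! Everything rests on `addSpan_reg`: each `R`-subbimodule `A` of `Q` is generated as an additive
group by its units. A bimodule is then determined by `reg A`, so quotients, closures, products and
primality can be tested on units; divisoriality makes `reg` and `addSpan` inverse to each other.

For that fact, Goldie's theorem makes `Q` semisimple. Let `T` be the additive group generated by
`H`. Given `q`, choose `x ∈ T` with `Q(q + x)` maximal. If `r = q + x ≠ 0` is not a unit, von
Neumann regularity gives non-zero idempotents `h`, `f` with `hr = 0 = rf`, and adding a non-zero
element of `hQf ∩ T` to `r` enlarges the left ideal (`exists_isUnit_add`). Such elements are built
from square-zero `n ∈ R`, which lie in `T` because `1 + n` is a unit. With a bimodule `A ≠ 0` in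
place of `T` and `q = 0`, the same argument yields a unit `c ∈ A`. For `a ∈ A`, some `u = c⁻¹a + x`
with `x ∈ T` is a unit, and `a = cu - cx` is in the additive span of the units of `A`.

For `N(H)`: its elements normalise `H`, so `A ↦ AH` sends ideals of `N(H)` to ideals of `H`, and a
divisorial `A` is recovered from `(AH)_v`. -/

namespace KrullRing

/-! ### Regular elements in essential left ideals -/

section Goldie

variable {R : Type*} [Ring R]

theorem leftAnn_rightAnn_leftAnn (S : Set R) : leftAnn (rightAnn (leftAnn S)) = leftAnn S := by
  ext x
  exact ⟨fun hx s hs => hx s fun t ht => ht s hs, fun hx s hs => hs x hx⟩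

theorem wellFounded_leftAnn_gt (h : ∀ S : ℕ → Set R, Monotone (fun n => leftAnn (S n)) →
      ∃ n, ∀ m, n ≤ m → leftAnn (S m) = leftAnn (S n)) :
    WellFounded (fun S T : Set R => leftAnn T ⊂ leftAnn S) := by
  rw [wellFounded_iff_isEmpty_descending_chain]
  refine ⟨fun ⟨f, hf⟩ => ?_⟩
  have hmono : StrictMono (fun n => leftAnn (f n)) := strictMono_nat_of_lt_succ hf
  obtain ⟨n, hn⟩ := h f hmono.monotone
  exact (hf n).ne (hn (n + 1) n.le_succ).symm

/-- Right annihilators reverse inclusions, and the triple annihilator identity keeps them strict: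
ACC on right annihilators is DCC on left ones. -/
theorem wellFounded_leftAnn_lt (h : ∀ S : ℕ → Set R, Monotone (fun n => rightAnn (S n)) →
      ∃ n, ∀ m, n ≤ m → rightAnn (S m) = rightAnn (S n)) :
    WellFounded (fun S T : Set R => leftAnn S ⊂ leftAnn T) := by
  rw [wellFounded_iff_isEmpty_descending_chain]
  refine ⟨fun ⟨f, hf⟩ => ?_⟩
  have hmono : Monotone (fun n => rightAnn (leftAnn (f n))) :=
    monotone_nat_of_le_succ fun n x hx s hs => hx s ((hf n).subset hs)
  obtain ⟨n, hn⟩ := h _ hmono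
  have h1 := congrArg leftAnn (hn (n + 1) n.le_succ)
  rw [leftAnn_rightAnn_leftAnn, leftAnn_rightAnn_leftAnn] at h1
  exact (hf n).ne h1

theorem mem_leftAnn_singleton {x a : R} : x ∈ leftAnn {a} ↔ x * a = 0 := by
  simp [leftAnn]

/-- In a prime ring with the ascending chain condition on left annihilators, a set of elements
closed under `a ↦ a (r a) ^ j` that contains a non-zero element
has a member `a` with some `r a` not nilpotent. -/
theorem exists_not_isNilpotent_mul (hp : IsPrimeRing R)
    (h : ∀ S : ℕ → Set R, Monotone (fun n => leftAnn (S n)) →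
      ∃ n, ∀ m, n ≤ m → leftAnn (S m) = leftAnn (S n))
    (N : Set R) (hN : ∀ a ∈ N, ∀ r : R, ∀ j : ℕ, a * (r * a) ^ j ∈ N)
    (hne : ∃ a ∈ N, a ≠ 0) : ∃ a ∈ N, ∃ r : R, ¬ IsNilpotent (r * a) := by
  by_contra! hnil
  obtain ⟨_, ⟨a, ⟨haN, ha0⟩, rfl⟩, hmax⟩ := (wellFounded_leftAnn_gt h).has_min
    ((fun a : R => ({a} : Set R)) '' {a | a ∈ N ∧ a ≠ 0})
    (by obtain ⟨a, h1, h2⟩ := hne; exact ⟨_, a, ⟨h1, h2⟩, rfl⟩)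
  -- The last non-zero `a * (r * a) ^ j` has the same left annihilator as `a`, by maximality, and `a
  -- * r` kills it.
  have key : ∀ r : R, a * r * a = 0 := by
    intro r
    have hex : ∃ j, a * (r * a) ^ j = 0 := by
      obtain ⟨k, hk⟩ := hnil a haN r
      exact ⟨k, by rw [hk, mul_zero]⟩
    classical
    obtain ⟨j, hj⟩ : ∃ j, Nat.find hex = j + 1 := by
      refine Nat.exists_eq_succ_of_ne_zero fun h0 => ha0 ?_
      simpa [h0] using Nat.find_spec hex
    have h1 : a * (r * a) ^ j ≠ 0 := Nat.find_min hex (by omega)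
    have h2 : a * (r * a) ^ (j + 1) = 0 := hj ▸ Nat.find_spec hex
    have h3 : leftAnn {a} ⊆ leftAnn {a * (r * a) ^ j} := fun x hx => by
      rw [mem_leftAnn_singleton] at hx ⊢
      rw [← mul_assoc, hx, zero_mul]
    have h4 : ¬ leftAnn {a} ⊂ leftAnn {a * (r * a) ^ j} :=
      hmax _ ⟨_, ⟨hN a haN r j, h1⟩, rfl⟩
    have h5 : a * r ∈ leftAnn {a * (r * a) ^ j} := by
      rw [mem_leftAnn_singleton, ← h2, pow_succ']
      simp only [mul_assoc]
    have h6 : leftAnn {a * (r * a) ^ j} ⊆ leftAnn {a} := by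
      by_contra h7
      exact h4 ⟨h3, h7⟩
    exact mem_leftAnn_singleton.1 (h6 h5)
  rcases hp.2 a a key with h0 | h0 <;> exact ha0 h0

/-- `E` is left essential: every non-zero element has a non-zero left multiple in `E`. -/
def IsLeftEssential (E : Set R) : Prop := ∀ x : R, x ≠ 0 → ∃ r : R, r * x ≠ 0 ∧ r * x ∈ E

theorem IsLeftEssential.mono {E F : Set R} (hE : IsLeftEssential E) (h : E ⊆ F) :
    IsLeftEssential F := fun x hx => by
  obtain ⟨r, h1, h2⟩ := hE x hx
  exact ⟨r, h1, h h2⟩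

/-- Prime rings with the ascending chain condition on left annihilators are left nonsingular. -/
theorem eq_zero_of_isLeftEssential_leftAnn (hp : IsPrimeRing R)
    (h : ∀ S : ℕ → Set R, Monotone (fun n => leftAnn (S n)) →
      ∃ n, ∀ m, n ≤ m → leftAnn (S m) = leftAnn (S n))
    (a : R) (ha : IsLeftEssential (leftAnn {a})) : a = 0 := by
  have hmul : ∀ a : R, IsLeftEssential (leftAnn {a}) → ∀ r, IsLeftEssential (leftAnn {a * r}) :=
    fun a ha r => ha.mono fun x hx => by
      rw [mem_leftAnn_singleton] at hx ⊢
      rw [← mul_assoc, hx, zero_mul]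
  -- Once the left annihilators of the powers are stable at `n`, a multiple `r * a ^ n ≠ 0` killing
  -- `a` would give `r * a ^ (n + 1) = 0`, hence `r * a ^ n = 0`.
  have hnil : ∀ a : R, IsLeftEssential (leftAnn {a}) → IsNilpotent a := by
    intro a ha
    obtain ⟨n, hn⟩ := h (fun n => {a ^ n}) (monotone_nat_of_le_succ fun n x hx => by
      rw [mem_leftAnn_singleton] at hx ⊢
      rw [pow_succ, ← mul_assoc, hx, zero_mul])
    refine ⟨n, ?_⟩
    by_contra h0
    obtain ⟨r, h1, h2⟩ := ha _ h0
    rw [mem_leftAnn_singleton, mul_assoc, ← pow_succ, ← mem_leftAnn_singleton,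
      hn (n + 1) n.le_succ, mem_leftAnn_singleton] at h2
    exact h1 h2
  by_contra h0
  obtain ⟨b, hb, r, hr⟩ := exists_not_isNilpotent_mul hp h {a | IsLeftEssential (leftAnn {a})}
    (fun a ha r j => hmul a ha _) ⟨a, ha, h0⟩
  obtain ⟨k, hk⟩ := hnil _ (hmul b hb r)
  refine hr ⟨k + 1, ?_⟩
  have : ∀ k, (r * b) ^ (k + 1) = r * (b * r) ^ k * b := by
    intro k
    induction k with
    | zero => simp
    | succ k ih => rw [pow_succ, ih, pow_succ]; simp only [mul_assoc]
  rw [this, hk, mul_zero, zero_mul]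

/-- In a prime ring with the ascending chain condition on left and on right annihilators, an
essential left ideal contains an element with zero left annihilator. -/
theorem exists_leftAnn_eq_zero (hp : IsPrimeRing R)
    (hl : ∀ S : ℕ → Set R, Monotone (fun n => leftAnn (S n)) →
      ∃ n, ∀ m, n ≤ m → leftAnn (S m) = leftAnn (S n))
    (hr : ∀ S : ℕ → Set R, Monotone (fun n => rightAnn (S n)) →
      ∃ n, ∀ m, n ≤ m → rightAnn (S m) = rightAnn (S n))
    (E : Ideal R) (hE : IsLeftEssential (E : Set R)) :
    ∃ a ∈ E, ∀ y : R, y * a = 0 → y = 0 := by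
  -- Minimise `leftAnn {a}` among the `a ∈ E` for which `a` and `a * a` have the same left
  -- annihilator; `0` is a candidate.
  obtain ⟨_, ⟨a, ⟨haE, ha⟩, rfl⟩, hmin⟩ := (wellFounded_leftAnn_lt hr).has_min
    ((fun a : R => ({a} : Set R)) '' {a | a ∈ E ∧ ∀ y, y * a * a = 0 → y * a = 0})
    ⟨_, 0, ⟨E.zero_mem, by simp⟩, rfl⟩
  refine ⟨a, haE, ?_⟩
  by_contra! hne
  obtain ⟨y, hya, hy⟩ := hne
  obtain ⟨r, hr0, hrE⟩ := hE y hy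
  have hN := exists_not_isNilpotent_mul hp hl {x | x ∈ E ∧ x * a = 0}
    (fun x hx r j => by
      have hpow : x * (r * x) ^ j = (x * r) ^ j * x := by
        induction j with
        | zero => simp
        | succ j ih => rw [pow_succ, ← mul_assoc, ih, pow_succ]; simp only [mul_assoc]
      refine ⟨?_, ?_⟩
      · rw [hpow]; exact E.mul_mem_left _ hx.1
      · rw [hpow, mul_assoc, hx.2, mul_zero])
    ⟨r * y, ⟨hrE, by rw [mul_assoc, hya, mul_zero]⟩, hr0⟩
  obtain ⟨x, ⟨hxE, hxa⟩, s, hs⟩ := hN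
  obtain ⟨n, hn⟩ := hl (fun n => {(s * x) ^ n}) (monotone_nat_of_le_succ fun n x hx => by
      rw [mem_leftAnn_singleton] at hx ⊢
      rw [pow_succ, ← mul_assoc, hx, zero_mul])
  have hcancel : ∀ m, n ≤ m → ∀ y, y * (s * x) ^ m = 0 → y * (s * x) ^ n = 0 := fun m hm y hy => by
    rwa [← mem_leftAnn_singleton, ← hn m hm, mem_leftAnn_singleton]
  -- The exponent `n + 1` keeps `b` in `E`, with `b * a = 0`, even when `n = 0`.
  set b := (s * x) ^ (n + 1) with hb
  have hbE : b ∈ E := by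
    rw [hb, pow_succ]; exact E.mul_mem_left _ (E.mul_mem_left _ hxE)
  have hba : b * a = 0 := by rw [hb, pow_succ, mul_assoc, mul_assoc, hxa, mul_zero, mul_zero]
  have hb0 : b ≠ 0 := fun h0 => hs ⟨n + 1, h0⟩
  have hbb : ∀ y, y * b * b = 0 → y * b = 0 := fun y hy => by
    rw [hb, mul_assoc, ← pow_add] at hy
    rw [hb, pow_succ, ← mul_assoc, hcancel _ (by omega) y hy, zero_mul]
  have hsplit : ∀ y, y * (a + b) = 0 → y * a = 0 ∧ y * b = 0 := fun y hy => by
    have h1 : y * a * a = 0 := by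
      have := congrArg (· * a) hy
      simpa [mul_add, add_mul, mul_assoc, hba] using this
    have h2 := ha y h1
    exact ⟨h2, by simpa [mul_add, h2] using hy⟩
  -- The left annihilator of `a + b` is the intersection of those of `a` and `b`. It is strictly
  -- smaller than that of `a`, since `b * a = 0` but `b * b ≠ 0`.
  refine hmin {a + b} ⟨a + b, ⟨E.add_mem haE hbE, fun y hy => ?_⟩, rfl⟩ ⟨fun y hy => ?_, fun h => ?_⟩
  · obtain ⟨h1, h2⟩ := hsplit _ hy
    have h3 : y * a * a = 0 := by simpa [mul_add, add_mul, mul_assoc, hba] using h1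
    have h4 := ha y h3
    have h5 : y * b * b = 0 := by simpa [mul_add, add_mul, h4] using h2
    rw [mul_add, h4, hbb y h5, add_zero]
  · rw [mem_leftAnn_singleton] at hy ⊢
    exact (hsplit y hy).1
  · have h1 : b ∈ leftAnn {a + b} := h (mem_leftAnn_singleton.2 hba)
    have h2 := (hsplit b (mem_leftAnn_singleton.1 h1)).2
    exact hb0 (by simpa using hbb 1 (by simpa using h2))

/-- A sequence of submodules is independent if each is disjoint from a submodule containing all
later ones. -/
theorem iSupIndep_of_disjoint_of_lt {A M : Type*} [Ring A] [AddCommGroup M] [Module A M]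
    (N T : ℕ → Submodule A M) (hd : ∀ n, Disjoint (N n) (T n)) (hle : ∀ n m, n < m → N m ≤ T n) :
    iSupIndep N := by
  rw [iSupIndep_iff_finsetSum_eq_zero_imp_eq_zero]
  intro s
  induction hc : s.card generalizing s with
  | zero => simp_all
  | succ c ih =>
    intro v hv h0
    have hne : s.Nonempty := Finset.card_pos.1 (by omega)
    set i := s.min' hne
    have hi : i ∈ s := s.min'_mem hne
    have hvi : v i = 0 := by
      refine Submodule.disjoint_def.1 (hd i) _ (hv i hi) ?_
      rw [← s.add_sum_erase _ hi, add_eq_zero_iff_eq_neg] at h0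
      rw [h0]
      refine (T i).neg_mem ((T i).sum_mem fun j hj => ?_)
      exact hle i j (s.min'_lt_of_mem_erase_min' hne hj) (hv j (Finset.mem_of_mem_erase hj))
    have h1 := ih (s.erase i) (by rw [Finset.card_erase_of_mem hi]; omega) v
      (fun j hj => hv j (Finset.mem_of_mem_erase hj))
      (by rwa [← s.add_sum_erase _ hi, hvi, zero_add] at h0)
    intro j hj
    by_cases hji : j = i
    · rw [hji, hvi]
    · exact h1 j (Finset.mem_erase.2 ⟨hji, hj⟩)

/-- In a ring of finite left uniform dimension, an element with zero left annihilator generates an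
essential left ideal. -/
theorem isLeftEssential_span_singleton (hf : HasFiniteUniformDim R R) (a : R)
    (ha : ∀ y : R, y * a = 0 → y = 0) : IsLeftEssential ((Ideal.span {a} : Ideal R) : Set R) := by
  intro x hx
  by_contra! hcon
  have hpow : ∀ n, ∀ y : R, y * a ^ n = 0 → y = 0 := by
    intro n
    induction n with
    | zero => simp
    | succ n ih =>
      intro y hy
      rw [pow_succ, ← mul_assoc] at hy
      exact ih y (ha _ hy)
  -- If `Rx` meets `Ra` trivially, then `Rx, Rxa, Rxa², …` are independent: the `n`-th is disjoint
  -- from `Ra ^ (n + 1)`, which contains all later ones.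
  refine hf ⟨fun n => Ideal.span {x * a ^ n}, fun n h => hx ?_,
    iSupIndep_of_disjoint_of_lt _ (fun n => Ideal.span {a ^ (n + 1)}) (fun n => ?_) ?_⟩
  · rw [Ideal.span_singleton_eq_bot] at h
    exact hpow n x h
  · rw [Submodule.disjoint_def]
    intro z h1 h2
    obtain ⟨y, rfl⟩ := Ideal.mem_span_singleton'.1 h1
    obtain ⟨w, hw⟩ := Ideal.mem_span_singleton'.1 h2
    have h3 : (y * x - w * a) * a ^ n = 0 := by
      rw [sub_mul, mul_assoc, mul_assoc w, ← pow_succ', hw, sub_self]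
    have h4 := sub_eq_zero.1 (hpow n _ h3)
    by_cases h5 : y * x = 0
    · rw [← mul_assoc, h5, zero_mul]
    · exact absurd (by rw [h4]; exact Ideal.mem_span_singleton'.2 ⟨w, rfl⟩) (hcon y h5)
  · intro n m hnm
    rw [Ideal.span_singleton_le_iff_mem, Ideal.mem_span_singleton']
    refine ⟨x * a ^ (m - (n + 1)), ?_⟩
    rw [mul_assoc, ← pow_add]
    congr 2
    omega

/-- Goldie's theorem: essential left ideals of a prime Goldie ring contain regular elements. -/
theorem exists_mem_nonZeroDivisors (hR : IsPrimeGoldie R)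
    (E : Ideal R) (hE : IsLeftEssential (E : Set R)) : ∃ a ∈ E, a ∈ nonZeroDivisors R := by
  obtain ⟨hp, hl, hr⟩ := hR
  obtain ⟨a, haE, ha⟩ := exists_leftAnn_eq_zero hp hl.2 hr.2 E hE
  refine ⟨a, haE, ?_, ha⟩
  intro y hy
  -- From `a * y = 0`, the left annihilator of `y` contains the essential left ideal `Ra`.
  refine eq_zero_of_isLeftEssential_leftAnn hp hl.2 y ?_
  refine (isLeftEssential_span_singleton hl.1 a ha).mono fun z hz => ?_
  obtain ⟨w, rfl⟩ := Ideal.mem_span_singleton'.1 hz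
  rw [mem_leftAnn_singleton, mul_assoc, hy, mul_zero]

/-- Every left ideal has a complement up to an essential left ideal. -/
theorem exists_disjoint_isLeftEssential_sup (J : Ideal R) :
    ∃ K : Ideal R, Disjoint J K ∧ IsLeftEssential ((J ⊔ K : Ideal R) : Set R) := by
  obtain ⟨K, hK⟩ := zorn_le₀ {K : Ideal R | Disjoint J K} (fun c hc hchain => by
    refine ⟨sSup c, ?_, fun x hx => le_sSup hx⟩
    exact hchain.directedOn.disjoint_sSup_right.2 fun b hb => hc hb)
  refine ⟨K, hK.prop, fun x hx => ?_⟩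
  by_contra! hcon
  -- Otherwise `K + Rx` would still be disjoint from `J`, against the maximality of `K`.
  have hdis : Disjoint (J ⊔ K) (Ideal.span {x}) := by
    rw [Submodule.disjoint_def]
    intro z h1 h2
    obtain ⟨w, rfl⟩ := Ideal.mem_span_singleton'.1 h2
    by_contra h3
    exact hcon w h3 h1
  have h1 : Disjoint J (K ⊔ Ideal.span {x}) :=
    Disjoint.disjoint_sup_right_of_disjoint_sup_left hK.prop hdis
  have h2 := hK.le_of_ge (y := K ⊔ Ideal.span {x}) h1 le_sup_left
  have hxK : x ∈ K := h2 (le_sup_right (a := K) (Ideal.mem_span_singleton_self x))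
  exact hcon 1 (by simpa using hx) (by simpa using le_sup_right (a := J) hxK)

end Goldie

/-! ### Semisimplicity of the quotient ring -/

variable {Q : Type*} [Ring Q]

/-- The left Ore condition gives common left denominators, so every element of `QK` is some `t⁻¹ k`.
-/
theorem exists_mul_mem_of_mem_span {R : Subring Q} (hQ : IsClassicalQuotientRing R) (K : Ideal R)
    {x : Q} (hx : x ∈ Ideal.span (R.subtype '' (K : Set R))) :
    ∃ t ∈ nonZeroDivisors R, ∃ k ∈ K, (t : Q) * x = k := by
  induction hx using Submodule.span_induction with
  | mem x h =>
    obtain ⟨k, hk, rfl⟩ := h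
    exact ⟨1, one_mem _, k, hk, by simp⟩
  | zero => exact ⟨1, one_mem _, 0, K.zero_mem, by simp⟩
  | add x y _ _ hx hy =>
    obtain ⟨t, ht, k, hk, hx⟩ := hx
    obtain ⟨u, hu, l, hl, hy⟩ := hy
    obtain ⟨v, hv⟩ := hQ.1 u hu
    obtain ⟨r, s, hs, h⟩ := hQ.2.1 ((t : Q) * ↑v⁻¹)
    have h1 : (s : Q) * t = r * u := by
      rw [← h, ← hv, mul_assoc, mul_assoc, Units.inv_mul, mul_one]
    refine ⟨s * t, mul_mem hs ht, s * k + r * l, K.add_mem (K.mul_mem_left _ hk)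
      (K.mul_mem_left _ hl), ?_⟩
    push_cast
    rw [mul_add, mul_assoc, hx, h1, mul_assoc, hy]
  | smul q x _ hx =>
    obtain ⟨t, ht, k, hk, hx⟩ := hx
    obtain ⟨v, hv⟩ := hQ.1 t ht
    obtain ⟨r, s, hs, h⟩ := hQ.2.1 (q * ↑v⁻¹)
    have h1 : (s : Q) * q = r * t := by
      rw [← h, ← hv, mul_assoc, mul_assoc, Units.inv_mul, mul_one]
    refine ⟨s, hs, r * k, K.mul_mem_left _ hk, ?_⟩
    push_cast
    rw [smul_eq_mul, ← mul_assoc, h1, mul_assoc, hx]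

/-- The classical quotient ring of a prime Goldie ring is semisimple. -/
theorem isSemisimpleRing_of_isPrimeGoldie {R : Subring Q} (hR : IsPrimeGoldie R)
    (hQ : IsClassicalQuotientRing R) : IsSemisimpleRing Q := by
  refine (isSemisimpleModule_iff Q Q).2 ⟨fun J => ?_⟩
  -- Take `K` complementing `J ∩ R` up to an essential left ideal. A regular `j + k` is a unit of
  -- `Q`, so `QK` complements `J`.
  obtain ⟨K, hJK, hess⟩ := exists_disjoint_isLeftEssential_sup (Ideal.comap R.subtype J)
  obtain ⟨s, hs, hreg⟩ := exists_mem_nonZeroDivisors hR _ hess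
  obtain ⟨j, hj, k, hk, rfl⟩ := Submodule.mem_sup.1 hs
  refine ⟨Ideal.span (R.subtype '' (K : Set R)), ?_, ?_⟩
  · rw [Submodule.disjoint_def]
    intro x hxJ hxK
    obtain ⟨t, ht, k, hk, h⟩ := exists_mul_mem_of_mem_span hQ K hxK
    have hk0 : k = 0 := Submodule.disjoint_def.1 hJK k
      (by change (k : Q) ∈ J; rw [← h]; exact J.smul_mem _ hxJ) hk
    rw [hk0, ZeroMemClass.coe_zero] at h
    exact (hQ.1 t ht).mul_right_eq_zero.1 h
  · rw [codisjoint_iff, Ideal.eq_top_iff_one]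
    obtain ⟨v, hv⟩ := hQ.1 _ hreg
    rw [← v.inv_mul, hv]
    refine Ideal.mul_mem_left _ _ ?_
    push_cast
    exact Submodule.add_mem_sup hj (Ideal.subset_span ⟨k, hk, rfl⟩)

end KrullRing

/-! ### Additive generation of bimodules by units -/

namespace KrullRing

variable {Q : Type*} [Ring Q]

section Semisimple

variable [IsSemisimpleRing Q]

/-- Split `Q = Qq ⊕ L` and `1 = yq + l`: then `ql = q - qyq` lies in `L ∩ Qq = 0`. -/
theorem exists_mul_mul_eq_self (q : Q) : ∃ y : Q, q * y * q = q := by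
  obtain ⟨L, hL⟩ := exists_isCompl (Ideal.span {q} : Ideal Q)
  have h1 : (1 : Q) ∈ Ideal.span {q} ⊔ L := by rw [hL.sup_eq_top]; trivial
  obtain ⟨a, ha, l, hl, h⟩ := Submodule.mem_sup.1 h1
  obtain ⟨y, rfl⟩ := Ideal.mem_span_singleton'.1 ha
  refine ⟨y, ?_⟩
  have h2 : q * l = q - q * y * q := by
    rw [eq_sub_iff_add_eq', mul_assoc, ← mul_add, h, mul_one]
  have h3 : q * l = 0 := Submodule.disjoint_def.1 hL.disjoint _
    (by rw [h2]; exact Ideal.mem_span_singleton'.2 ⟨1 - q * y, by rw [sub_mul, one_mul]⟩)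
    (L.smul_mem _ hl)
  rw [h3] at h2
  exact (sub_eq_zero.1 h2.symm).symm

/-- In a semisimple ring, every element can be moved to a unit by an element of an additive subgroup
`T` that meets sufficiently many corners `h Q f`. -/
theorem exists_isUnit_add (T : AddSubgroup Q)
    (hT0 : ∃ x ∈ T, x ≠ 0) (hT : ∀ r h f : Q, r ≠ 0 → h * h = h → f * f = f → h ≠ 0 → f ≠ 0 → h * r = 0 → r * f = 0 →
      ∃ y : Q, h * y * f ∈ T ∧ h * y * f ≠ 0) (q : Q) : ∃ x ∈ T, IsUnit (q + x) := by
  obtain ⟨_, ⟨x, hx, rfl⟩, hmax⟩ := set_has_maximal_iff_noetherian.2 (inferInstance : IsNoetherian Q Q)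
    ((fun x => (Ideal.span {q + x} : Ideal Q)) '' T) ⟨_, 0, T.zero_mem, rfl⟩
  refine ⟨x, hx, ?_⟩
  by_contra hu
  set r := q + x
  have hr0 : r ≠ 0 := fun hr0 => by
    obtain ⟨z, hz, hz0⟩ := hT0
    refine hmax _ ⟨x + z, T.add_mem hx hz, rfl⟩ ?_
    simp only [← add_assoc]
    change Ideal.span {r} < Ideal.span {r + z}
    rw [hr0, zero_add, Ideal.span_singleton_zero, bot_lt_iff_ne_bot]
    exact fun h => hz0 (Ideal.span_singleton_eq_bot.1 h)
  obtain ⟨y, hy⟩ := exists_mul_mul_eq_self r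
  -- One-sided inverses in `Q` are two-sided, so neither complementary idempotent of a non-unit
  -- vanishes.
  have hry : 1 - r * y ≠ 0 := fun h =>
    hu (IsUnit.of_mul_eq_one y (sub_eq_zero.1 h).symm)
  have hyr : 1 - y * r ≠ 0 := fun h =>
    hu (IsUnit.of_mul_eq_one y (mul_eq_one_symm (sub_eq_zero.1 h).symm))
  have hr : (1 - r * y) * r = 0 := by rw [sub_mul, hy, one_mul, sub_self]
  have hf : r * (1 - y * r) = 0 := by rw [mul_sub, ← mul_assoc, hy, mul_one, sub_self]
  have hrr : (1 - r * y) * (1 - r * y) = 1 - r * y := by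
    rw [mul_sub, ← mul_assoc, hr, zero_mul, mul_one, sub_zero]
  have hff : (1 - y * r) * (1 - y * r) = 1 - y * r := by
    rw [sub_mul, mul_assoc, hf, mul_zero, one_mul, sub_zero]
  obtain ⟨w, hw, hw0⟩ := hT r _ _ hr0 hrr hff hry hyr hr hf
  set z := (1 - r * y) * w * (1 - y * r)
  have hz : (1 - r * y) * (r + z) = z := by
    simp only [z]
    rw [mul_add, hr, zero_add, ← mul_assoc, ← mul_assoc, hrr]
  have hzf : z * (1 - y * r) = z := by
    simp only [z]
    rw [mul_assoc, hff]
  have hzmem : z ∈ Ideal.span {r + z} := Ideal.mem_span_singleton'.2 ⟨_, hz⟩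
  -- `Q(r + z)` contains `z`, hence `r`; but `z ∉ Qr`, because `1 - y * r` kills `Qr` on the right
  -- and fixes `z ≠ 0`.
  refine hmax _ ⟨x + z, T.add_mem hx hw, rfl⟩ (lt_of_le_of_ne ?_ fun heq => hw0 ?_)
  · simp only [← add_assoc]
    rw [Ideal.span_singleton_le_iff_mem]
    simpa using sub_mem (Ideal.mem_span_singleton_self (r + z)) hzmem
  · simp only [← add_assoc] at heq
    have h1 : z ∈ Ideal.span {r} := by
      rw [show (Ideal.span {r} : Ideal Q) = Ideal.span {r + z} from heq]
      exact hzmem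
    obtain ⟨v, hv⟩ := Ideal.mem_span_singleton'.1 h1
    rw [← hzf, ← hv, mul_assoc, hf, mul_zero]

end Semisimple

variable {R : Subring Q}

theorem exists_units_mul_mem (hQ : IsClassicalQuotientRing R) (q : Q) :
    ∃ u ∈ regMonoid R, (u : Q) * q ∈ R := by
  obtain ⟨r, s, hs, h⟩ := hQ.2.1 q
  obtain ⟨u, hu, hus⟩ := (mem_regMonoid_iff R hQ s).2 ⟨s, hs, rfl⟩
  exact ⟨u, hu, by rw [hus, h]; exact r.2⟩

theorem exists_mul_units_mem (hQ : IsClassicalQuotientRing R) (q : Q) :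
    ∃ u ∈ regMonoid R, q * (u : Q) ∈ R := by
  obtain ⟨r, s, hs, h⟩ := hQ.2.2 q
  obtain ⟨u, hu, hus⟩ := (mem_regMonoid_iff R hQ s).2 ⟨s, hs, rfl⟩
  exact ⟨u, hu, by rw [hus, h]; exact r.2⟩

/-- Clearing the outer denominators reduces this to primeness of `R`; the middle factor can stay in
`R`. -/
theorem exists_mul_mul_ne_zero (hR : IsPrimeRing R) (hQ : IsClassicalQuotientRing R) {p q : Q}
    (hp : p ≠ 0) (hq : q ≠ 0) : ∃ r ∈ R, p * r * q ≠ 0 := by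
  obtain ⟨u, -, hup⟩ := exists_units_mul_mem hQ p
  obtain ⟨v, -, hqv⟩ := exists_mul_units_mem hQ q
  by_contra! hcon
  rcases hR.2 ⟨u * p, hup⟩ ⟨q * v, hqv⟩ (fun r => Subtype.ext (by
    change u * p * r * (q * v) = 0
    rw [mul_assoc (u : Q), mul_assoc (u : Q), ← mul_assoc (p * r), hcon r r.2, zero_mul,
      mul_zero])) with h | h
  · exact hp ((Units.mul_right_eq_zero u).1 (congrArg Subtype.val h))
  · exact hq ((Units.mul_left_eq_zero v).1 (congrArg Subtype.val h))

/-- Left and right `R`-submodules of `Q`. -/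
def IsBimodule (R : Subring Q) (A : AddSubgroup Q) : Prop :=
  (∀ r ∈ R, ∀ x ∈ A, r * x ∈ A) ∧ (∀ r ∈ R, ∀ x ∈ A, x * r ∈ A)

theorem exists_corner_mem_of_isBimodule (hR : IsPrimeRing R) (hQ : IsClassicalQuotientRing R)
    {A : AddSubgroup Q} (hA : IsBimodule R A) (hA0 : A ≠ ⊥) {h f : Q} (hh : h ≠ 0) (hf : f ≠ 0) :
    ∃ y : Q, h * y * f ∈ A ∧ h * y * f ≠ 0 := by
  obtain ⟨a, ha, ha0⟩ := A.bot_or_exists_ne_zero.resolve_left hA0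
  obtain ⟨u, -, hu⟩ := exists_mul_units_mem hQ h
  obtain ⟨v, -, hv⟩ := exists_units_mul_mem hQ f
  have hu0 : h * u ≠ 0 := fun h0 => hh ((Units.mul_left_eq_zero u).1 h0)
  have hv0 : v * f ≠ 0 := fun h0 => hf ((Units.mul_right_eq_zero v).1 h0)
  obtain ⟨r, hr, h1⟩ := exists_mul_mul_ne_zero hR hQ hu0 ha0
  obtain ⟨s, hs, h2⟩ := exists_mul_mul_ne_zero hR hQ h1 hv0
  refine ⟨u * r * a * s * v, ?_⟩
  have e : h * (u * r * a * s * v) * f = h * u * r * a * s * (v * f) := by simp only [mul_assoc]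
  rw [e]
  exact ⟨hA.2 _ hv _ (hA.2 _ hs _ (hA.1 _ (R.mul_mem hu hr) _ ha)), h2⟩

/-- The additive group generated by a set of units. -/
def addSpan (X : Set Qˣ) : AddSubgroup Q := AddSubgroup.closure ((fun u : Qˣ => (u : Q)) '' X)

theorem mem_addSpan {X : Set Qˣ} {u : Qˣ} (hu : u ∈ X) : (u : Q) ∈ addSpan X :=
  AddSubgroup.subset_closure ⟨u, hu, rfl⟩

theorem addSpan_le {X : Set Qˣ} {A : AddSubgroup Q} : addSpan X ≤ A ↔ X ⊆ reg A := by
  rw [addSpan, AddSubgroup.closure_le, Set.image_subset_iff]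
  rfl

theorem mul_mem_of_mem_addSpan_right {X : Set Qˣ} {A : AddSubgroup Q} {c : Q}
    (h : ∀ u ∈ X, c * u ∈ A) {x : Q} (hx : x ∈ addSpan X) : c * x ∈ A :=
  (addSpan_le (A := A.comap (AddMonoidHom.mulLeft c))).2 h hx

theorem mul_mem_of_mem_addSpan_left {X : Set Qˣ} {A : AddSubgroup Q} {c : Q}
    (h : ∀ u ∈ X, u * c ∈ A) {x : Q} (hx : x ∈ addSpan X) : x * c ∈ A :=
  (addSpan_le (A := A.comap (AddMonoidHom.mulRight c))).2 h hx

theorem mul_le_iff {A B C : AddSubgroup Q} : A * B ≤ C ↔ ∀ a ∈ A, ∀ b ∈ B, a * b ∈ C :=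
  AddSubmonoid.mul_le

theorem mul_mem_mul {A B : AddSubgroup Q} {a b : Q} (ha : a ∈ A) (hb : b ∈ B) : a * b ∈ A * B :=
  AddSubmonoid.mul_mem_mul ha hb

theorem addSpan_mul_addSpan (X Y : Set Qˣ) : addSpan X * addSpan Y = addSpan (X * Y) := by
  refine le_antisymm ?_ (addSpan_le.2 ?_)
  · exact mul_le_iff.2 fun x hx y hy => mul_mem_of_mem_addSpan_left (fun u hu =>
      mul_mem_of_mem_addSpan_right (fun v hv => mem_addSpan (u := u * v) (Set.mul_mem_mul hu hv)) hy) hx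
  · rintro _ ⟨u, hu, v, hv, rfl⟩
    exact mul_mem_mul (mem_addSpan hu) (mem_addSpan hv)

theorem mul_mem_addSpan_regMonoid {x y : Q} (hx : x ∈ addSpan (regMonoid R : Set Qˣ))
    (hy : y ∈ addSpan (regMonoid R : Set Qˣ)) : x * y ∈ addSpan (regMonoid R : Set Qˣ) := by
  have : (regMonoid R : Set Qˣ) * (regMonoid R : Set Qˣ) = regMonoid R :=
    Submonoid.coe_mul_self_eq _
  rw [← this, ← addSpan_mul_addSpan]
  exact mul_mem_mul hx hy

theorem one_mem_addSpan_regMonoid : (1 : Q) ∈ addSpan (regMonoid R : Set Qˣ) :=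
  mem_addSpan (u := 1) (regMonoid R).one_mem

/-- `1 + x` has inverse `1 - x`, so `x = (1 + x) - 1` is a difference of elements of `H`. -/
theorem mem_addSpan_regMonoid_of_mul_self_eq_zero {x : Q} (hx : x ∈ R) (h : x * x = 0) :
    x ∈ addSpan (regMonoid R : Set Qˣ) := by
  have h1 : (⟨1 + x, 1 - x, by simp [mul_sub, add_mul, h], by simp [mul_add, sub_mul, h]⟩ : Qˣ) ∈
      regMonoid R := R.add_mem R.one_mem hx
  simpa using sub_mem (mem_addSpan h1) one_mem_addSpan_regMonoid

/-- Elements of `R` in the corners `hQ(1 - h)` and `(1 - f)Qf` have square zero, hence lie in the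
span. By primeness they can be joined through any `z` in the span with `(1 - h)z(1 - f) ≠ 0`. -/
theorem exists_corner_mem_addSpan_regMonoid (hR : IsPrimeRing R) (hQ : IsClassicalQuotientRing R)
    {h f : Q} (hhh : h * h = h) (hff : f * f = f) (hh : h ≠ 0) (hf : f ≠ 0) (hh1 : 1 - h ≠ 0)
    (hf1 : 1 - f ≠ 0) : ∃ y : Q, h * y * f ∈ addSpan (regMonoid R : Set Qˣ) ∧ h * y * f ≠ 0 := by
  obtain ⟨t, -, ht⟩ := exists_mul_units_mem hQ h
  obtain ⟨t', -, ht'⟩ := exists_units_mul_mem hQ f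
  obtain ⟨s, -, hs⟩ := exists_units_mul_mem hQ (1 - h)
  obtain ⟨s', -, hs'⟩ := exists_mul_units_mem hQ (1 - f)
  have left_ne : ∀ {x : Q} (u : Qˣ), x ≠ 0 → u * x ≠ 0 := fun u hx h0 =>
    hx ((Units.mul_right_eq_zero u).1 h0)
  have right_ne : ∀ {x : Q} (u : Qˣ), x ≠ 0 → x * u ≠ 0 := fun u hx h0 =>
    hx ((Units.mul_left_eq_zero u).1 h0)
  have h1h : (1 - h) * h = 0 := by rw [sub_mul, hhh, one_mul, sub_self]
  have h1f : f * (1 - f) = 0 := by rw [mul_sub, hff, mul_one, sub_self]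
  obtain ⟨z, hz, hz0⟩ : ∃ z ∈ addSpan (regMonoid R : Set Qˣ), (1 - h) * z * (1 - f) ≠ 0 := by
    -- `z = 1` works unless this product vanishes. Then `h(1 - f) = 1 - f ≠ 0`, and a square-zero
    -- `z` in `(1 - h)Qh` serves.
    by_cases h0 : (1 - h) * (1 - f) = 0
    · obtain ⟨a, -, ha⟩ := exists_mul_units_mem hQ (1 - h)
      have hhf : h * (1 - f) ≠ 0 := fun h2 => hf1 (by
        rw [sub_mul, h2, one_mul, sub_zero] at h0
        exact h0)
      obtain ⟨b, -, hb⟩ := exists_units_mul_mem hQ h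
      obtain ⟨r, hr, hr0⟩ := exists_mul_mul_ne_zero hR hQ (right_ne a hh1) (left_ne b hhf)
      refine ⟨(1 - h) * a * r * (b * h), mem_addSpan_regMonoid_of_mul_self_eq_zero
        (R.mul_mem (R.mul_mem ha hr) hb) ?_, ?_⟩
      · have e : (1 - h) * a * r * (b * h) * ((1 - h) * a * r * (b * h)) =
            (1 - h) * a * r * b * (h * (1 - h)) * a * r * (b * h) := by simp only [mul_assoc]
        rw [e, mul_sub, hhh, mul_one, sub_self, mul_zero, zero_mul, zero_mul, zero_mul]
      · have e : (1 - h) * ((1 - h) * a * r * (b * h)) * (1 - f) =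
            (1 - h) * (1 - h) * a * r * (b * (h * (1 - f))) := by simp only [mul_assoc]
        rwa [e, mul_sub (1 - h) 1 h, h1h, mul_one, sub_zero]
    · exact ⟨1, one_mem_addSpan_regMonoid, by rwa [mul_one]⟩
  obtain ⟨r, hr, hr0⟩ := exists_mul_mul_ne_zero hR hQ (right_ne t hh) (left_ne s (right_ne s' hz0))
  obtain ⟨r', hr', hr0'⟩ := exists_mul_mul_ne_zero hR hQ hr0 (left_ne t' hf)
  have hx : h * t * r * (s * (1 - h)) ∈ addSpan (regMonoid R : Set Qˣ) :=
    mem_addSpan_regMonoid_of_mul_self_eq_zero (R.mul_mem (R.mul_mem ht hr) hs) (by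
      have e : h * t * r * (s * (1 - h)) * (h * t * r * (s * (1 - h))) =
        h * t * r * s * ((1 - h) * h) * (t * r * (s * (1 - h))) := by simp only [mul_assoc]
      rw [e, h1h, mul_zero, zero_mul])
  have hy : (1 - f) * s' * r' * (t' * f) ∈ addSpan (regMonoid R : Set Qˣ) :=
    mem_addSpan_regMonoid_of_mul_self_eq_zero (R.mul_mem (R.mul_mem hs' hr') ht') (by
      have e : (1 - f) * s' * r' * (t' * f) * ((1 - f) * s' * r' * (t' * f)) =
        (1 - f) * s' * r' * t' * (f * (1 - f)) * (s' * r' * (t' * f)) := by simp only [mul_assoc]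
      rw [e, h1f, mul_zero, zero_mul])
  refine ⟨t * r * (s * (1 - h)) * z * ((1 - f) * s' * r' * t'), ?_⟩
  have e : h * (t * r * (s * (1 - h)) * z * ((1 - f) * s' * r' * t')) * f =
      h * t * r * (s * (1 - h)) * z * ((1 - f) * s' * r' * (t' * f)) := by simp only [mul_assoc]
  have e' : h * t * r * (s * (1 - h)) * z * ((1 - f) * s' * r' * (t' * f)) =
      h * t * r * (s * ((1 - h) * z * (1 - f) * s')) * r' * (t' * f) := by simp only [mul_assoc]
  rw [e]
  exact ⟨mul_mem_addSpan_regMonoid (mul_mem_addSpan_regMonoid hx hz) hy, by rwa [e']⟩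

theorem exists_add_isUnit_of_addSpan_regMonoid (hR : IsPrimeGoldie R)
    (hQ : IsClassicalQuotientRing R) (q : Q) :
    ∃ x ∈ addSpan (regMonoid R : Set Qˣ), IsUnit (q + x) := by
  have := isSemisimpleRing_of_isPrimeGoldie hR hQ
  -- If `1 - h` or `1 - f` were zero, `hr = 0` or `rf = 0` would force `r = 0`.
  refine exists_isUnit_add _ ⟨1, one_mem_addSpan_regMonoid, ?_⟩ (fun r h f hr hhh hff hh hf hhr hrf =>
    exists_corner_mem_addSpan_regMonoid hR.1 hQ hhh hff hh hf (fun h0 => hr ?_) fun h0 => hr ?_) q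
  · exact fun h => hR.1.1.exists_pair_ne.elim fun a ⟨b, hab⟩ => hab (Subtype.ext (by
      rw [← mul_one (a : Q), ← mul_one (b : Q), h, mul_zero, mul_zero]))
  · rwa [← sub_eq_zero.1 h0, one_mul] at hhr
  · rwa [← sub_eq_zero.1 h0, mul_one] at hrf

/-- A non-zero bimodule contains a unit. -/
theorem exists_unit_mem (hR : IsPrimeGoldie R) (hQ : IsClassicalQuotientRing R)
    {A : AddSubgroup Q} (hA : IsBimodule R A) (hA0 : A ≠ ⊥) : (reg A).Nonempty := by
  have := isSemisimpleRing_of_isPrimeGoldie hR hQ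
  obtain ⟨x, hx, u, hu⟩ := exists_isUnit_add A
    (A.bot_or_exists_ne_zero.resolve_left hA0) (fun r h f _ _ _ hh hf _ _ => exists_corner_mem_of_isBimodule hR.1 hQ hA hA0 hh hf) 0
  exact ⟨u, by change (u : Q) ∈ A; rw [hu, zero_add]; exact hx⟩

/-- A bimodule is generated as an additive group by its units. -/
theorem addSpan_reg (hR : IsPrimeGoldie R) (hQ : IsClassicalQuotientRing R)
    {A : AddSubgroup Q} (hA : IsBimodule R A) : addSpan (reg A) = A := by
  refine le_antisymm (addSpan_le.2 subset_rfl) ?_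
  by_cases hA0 : A = ⊥
  · rw [hA0]; exact bot_le
  intro a ha
  obtain ⟨c, hc⟩ := exists_unit_mem hR hQ hA hA0
  obtain ⟨x, hx, u, hu⟩ := exists_add_isUnit_of_addSpan_regMonoid hR hQ (↑c⁻¹ * a)
  -- Since `c * H ⊆ reg A`, adding `cx` to `a` costs only a sum of units of `A`, and the result `cu`
  -- is a unit of `A`.
  have hcx : (c : Q) * x ∈ addSpan (reg A) :=
    mul_mem_of_mem_addSpan_right (fun v hv => mem_addSpan (u := c * v) (hA.2 _ hv _ hc)) hx
  have hcu : ((c * u : Qˣ) : Q) = a + c * x := by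
    rw [Units.val_mul, hu, mul_add, Units.mul_inv_cancel_left]
  have hmem : c * u ∈ reg A := by
    change ((c * u : Qˣ) : Q) ∈ A
    rw [hcu]
    exact add_mem ha (addSpan_le.2 subset_rfl hcx)
  rw [← add_sub_cancel_right a (c * x), ← hcu]
  exact sub_mem (mem_addSpan hmem) hcx

end KrullRing

/-! ### Divisorial closure in monoids -/

namespace KrullMonoid

variable {G : Type*} [Group G] {H : Submonoid G}

theorem coe_mul_eq_self {A : Set G} (h : ∀ g ∈ H, ∀ x ∈ A, g * x ∈ A) : (H : Set G) * A = A :=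
  Set.Subset.antisymm (Set.mul_subset_iff.2 h) fun x hx => ⟨1, H.one_mem, x, hx, one_mul x⟩

theorem mul_coe_eq_self {A : Set G} (h : ∀ x ∈ A, ∀ g ∈ H, x * g ∈ A) : A * (H : Set G) = A :=
  Set.Subset.antisymm (Set.mul_subset_iff.2 h) fun x hx => ⟨x, hx, 1, H.one_mem, mul_one x⟩

theorem IsFractionalIdeal.mul_mem_left {A : Set G} (hA : IsFractionalIdeal H A) {g x : G}
    (hg : g ∈ H) (hx : x ∈ A) : g * x ∈ A := hA.1.subset (Set.mul_mem_mul hg hx)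

theorem IsFractionalIdeal.mul_mem_right {A : Set G} (hA : IsFractionalIdeal H A) {g x : G}
    (hx : x ∈ A) (hg : g ∈ H) : x * g ∈ A := hA.2.1.subset (Set.mul_mem_mul hx hg)

theorem isIdeal_of_subset {A : Set G} (hl : ∀ g ∈ H, ∀ x ∈ A, g * x ∈ A)
    (hr : ∀ x ∈ A, ∀ g ∈ H, x * g ∈ A) (h : A ⊆ H) : IsIdeal H A :=
  ⟨⟨coe_mul_eq_self hl, mul_coe_eq_self hr, ⟨1, H.one_mem, fun x hx => by simpa using h hx⟩,
    ⟨1, H.one_mem, fun x hx => by simpa using h hx⟩⟩, h⟩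

theorem subset_leftClosure (A : Set G) : A ⊆ leftClosure H A := fun x hx _ hb => hb x hx

theorem leftClosure_leftQuot (A : Set G) : leftClosure H (leftQuot H A) = leftQuot H A :=
  Set.Subset.antisymm (fun _ hx b hb => hx b fun _ hc => hc b hb) (subset_leftClosure _)

theorem rightClosure_rightQuot (A : Set G) : rightClosure H (rightQuot H A) = rightQuot H A :=
  Set.Subset.antisymm (fun _ hx b hb => hx b fun _ hc => hc b hb) fun x hx _ hb => hb x hx

theorem leftClosure_mono {A B : Set G} (h : A ⊆ B) : leftClosure H A ⊆ leftClosure H B :=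
  fun _ hx b hb => hx b fun a ha => hb a (h ha)

/-- When defined, `A_v` is both a left and a right quotient, hence fixed by both closures; each
description supplies one of the two bounds. -/
theorem vClosure_mem_divFrac {A : Set G} (hA : IsFractionalIdeal H A) (hv : HasVClosure H A) :
    vClosure H A ∈ divFrac H := by
  obtain ⟨a, ha, haA⟩ := hA.2.2.1
  obtain ⟨b, hb, hbA⟩ := hA.2.2.2
  have h1 : leftClosure H (vClosure H A) = vClosure H A := leftClosure_leftQuot _
  have h2 : rightClosure H (vClosure H A) = vClosure H A := by
    rw [vClosure, show leftClosure H A = rightClosure H A from hv]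
    exact rightClosure_rightQuot _
  refine ⟨⟨coe_mul_eq_self fun g hg x hx c hc => ?_, mul_coe_eq_self fun x hx g hg c hc => ?_,
    ⟨a, ha, fun x hx => hx a haA⟩, ⟨b, hb, fun x hx => ?_⟩⟩, h1.trans h2.symm, h1.symm⟩
  · rw [mul_assoc]; exact H.mul_mem hg (hx c hc)
  · rw [mul_assoc]
    exact hx _ fun y hy => by rw [← mul_assoc]; exact hc _ (hA.mul_mem_right hy hg)
  · have hx : x ∈ rightClosure H A := hv.subset hx
    exact hx b hbA

/-- The hypothesis concerns ideals only. Multiplying `A` by the set of all `h ∈ H` with `Ah ⊆ H`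
gives a non-empty ideal, still stable under any `x` with `xA ⊆ A`. -/
theorem leftQuot_self_subset (hc : IsComplIntClosed H) {A : Set G} (hA : IsFractionalIdeal H A)
    (hne : A.Nonempty) : leftQuot A A ⊆ H := by
  obtain ⟨a, ha⟩ := hne
  obtain ⟨b, hb, hbA⟩ := hA.2.2.1
  have h1 := (hc (A * {h | h ∈ H ∧ ∀ x ∈ A, x * h ∈ H}) (isIdeal_of_subset ?_ ?_ ?_)
    ⟨a * b, Set.mul_mem_mul ha ⟨hb, hbA⟩⟩).1
  · intro x hx
    refine h1.subset ?_
    rintro _ ⟨y, hy, h, hh, rfl⟩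
    exact ⟨x * y, hx y hy, h, hh, mul_assoc _ _ _⟩
  · rintro g hg _ ⟨y, hy, h, hh, rfl⟩
    exact ⟨g * y, hA.mul_mem_left hg hy, h, hh, mul_assoc _ _ _⟩
  · rintro _ ⟨y, hy, h, hh, rfl⟩ g hg
    exact ⟨y, hy, h * g, ⟨H.mul_mem hh.1 hg, fun x hx => by
      rw [← mul_assoc]; exact H.mul_mem (hh.2 x hx) hg⟩, (mul_assoc _ _ _).symm⟩
  · rintro _ ⟨y, hy, h, hh, rfl⟩
    exact hh.2 y hy

theorem rightQuot_self_subset (hc : IsComplIntClosed H) {A : Set G} (hA : IsFractionalIdeal H A)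
    (hne : A.Nonempty) : rightQuot A A ⊆ H := by
  obtain ⟨a, ha⟩ := hne
  obtain ⟨b, hb, hbA⟩ := hA.2.2.2
  have h1 := (hc ({h | h ∈ H ∧ ∀ x ∈ A, h * x ∈ H} * A) (isIdeal_of_subset ?_ ?_ ?_)
    ⟨b * a, Set.mul_mem_mul ⟨hb, hbA⟩ ha⟩).2
  · intro x hx
    refine h1.subset ?_
    rintro _ ⟨h, hh, y, hy, rfl⟩
    exact ⟨h, hh, y * x, hx y hy, (mul_assoc _ _ _).symm⟩
  · rintro g hg _ ⟨h, hh, y, hy, rfl⟩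
    exact ⟨g * h, ⟨H.mul_mem hg hh.1, fun x hx => by
      rw [mul_assoc]; exact H.mul_mem hg (hh.2 x hx)⟩, y, hy, mul_assoc _ _ _⟩
  · rintro _ ⟨h, hh, y, hy, rfl⟩ g hg
    exact ⟨h, hh, y * g, hA.mul_mem_right hy hg, (mul_assoc _ _ _).symm⟩
  · rintro _ ⟨h, hh, y, hy, rfl⟩
    exact hh.2 y hy

/-- If `xA ⊆ H` and `a ∈ A`, then `(ax)A ⊆ aH ⊆ A`, so `ax ∈ H`; symmetrically on the other side. -/
theorem leftQuot_eq_rightQuot (hc : IsComplIntClosed H) {A : Set G} (hA : IsFractionalIdeal H A)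
    (hne : A.Nonempty) : leftQuot H A = rightQuot H A := by
  refine Set.Subset.antisymm (fun x hx a ha => leftQuot_self_subset hc hA hne fun y hy => ?_)
    fun x hx a ha => rightQuot_self_subset hc hA hne fun y hy => ?_
  · rw [mul_assoc]; exact hA.mul_mem_right ha (hx y hy)
  · rw [← mul_assoc]; exact hA.mul_mem_left (hx y hy) ha

theorem isFractionalIdeal_leftQuot (hc : IsComplIntClosed H) {A : Set G}
    (hA : IsFractionalIdeal H A) (hne : A.Nonempty) : IsFractionalIdeal H (leftQuot H A) := by
  obtain ⟨a, ha⟩ := hne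
  obtain ⟨b, hb, hbA⟩ := hA.2.2.1
  refine ⟨coe_mul_eq_self fun g hg x hx c hcA => ?_, mul_coe_eq_self fun x hx g hg c hcA => ?_,
    ⟨a * b, hbA a ha, fun x hx => hx _ (hA.mul_mem_right ha hb)⟩,
    ⟨a * b, hbA a ha, fun x hx => ?_⟩⟩
  · rw [mul_assoc]; exact H.mul_mem hg (hx c hcA)
  · rw [mul_assoc]; exact hx _ (hA.mul_mem_left hg hcA)
  · rw [leftQuot_eq_rightQuot hc hA ⟨a, ha⟩] at hx
    exact hx _ (hA.mul_mem_right ha hb)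

/-- Over a completely integrally closed monoid, `A_v` is defined for every fractional ideal `A`. -/
theorem hasVClosure_of_isComplIntClosed (hc : IsComplIntClosed H) {A : Set G}
    (hA : IsFractionalIdeal H A) : HasVClosure H A := by
  rcases A.eq_empty_or_nonempty with rfl | hne
  -- Both inner quotients of `∅` are all of `G`, so an element of either closure forces `H = G`.
  · refine Set.Subset.antisymm (fun x hx b _ => ?_) fun x hx b _ => ?_
    · have : x * (x⁻¹ * b * x) ∈ H := hx _ (by simp [rightQuot])
      simpa [mul_assoc] using this
    · have : (x * b * x⁻¹) * x ∈ H := hx _ (by simp [leftQuot])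
      simpa [mul_assoc] using this
  · obtain ⟨b, hb, hbA⟩ := hA.2.2.2
    rw [HasVClosure, leftClosure, rightClosure, ← leftQuot_eq_rightQuot hc hA hne]
    exact leftQuot_eq_rightQuot hc (isFractionalIdeal_leftQuot hc hA hne) ⟨b, hbA⟩

/-! ### The normalizing submonoid -/

theorem isNormalElt_iff {a : G} :
    IsNormalElt H a ↔ ∀ h ∈ H, a * h * a⁻¹ ∈ H ∧ a⁻¹ * h * a ∈ H := by
  constructor
  · intro h x hx
    constructor
    · obtain ⟨y, hy, b, hb, h1⟩ := h.subset (Set.mul_mem_mul (Set.mem_singleton a) hx)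
      rw [Set.mem_singleton_iff.1 hb] at h1
      exact eq_mul_inv_of_mul_eq h1 ▸ hy
    · obtain ⟨b, hb, y, hy, h1⟩ := h.symm.subset (Set.mul_mem_mul hx (Set.mem_singleton a))
      rw [Set.mem_singleton_iff.1 hb] at h1
      rw [mul_assoc]
      exact eq_inv_mul_of_mul_eq h1 ▸ hy
  · intro h
    refine Set.Subset.antisymm ?_ ?_
    · rintro _ ⟨b, hb, x, hx, rfl⟩
      rw [Set.mem_singleton_iff.1 hb]
      exact ⟨_, (h x hx).1, a, rfl, by simp⟩
    · rintro _ ⟨x, hx, b, hb, rfl⟩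
      rw [Set.mem_singleton_iff.1 hb]
      exact ⟨a, rfl, _, (h x hx).2, by simp [mul_assoc]⟩

theorem IsNormalElt.mul {a b : G} (ha : IsNormalElt H a) (hb : IsNormalElt H b) :
    IsNormalElt H (a * b) := by
  unfold IsNormalElt at *
  rw [← Set.singleton_mul_singleton, mul_assoc, hb, ← mul_assoc, ha, mul_assoc]

theorem isNormalElt_of_mem_closure {g : G}
    (hg : g ∈ Subgroup.closure (normalizingSubmonoid H : Set G)) : IsNormalElt H g := by
  induction hg using Subgroup.closure_induction with
  | mem x hx => exact hx.2
  | one => simp [IsNormalElt]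
  | mul x y _ _ hx hy => exact hx.mul hy
  | inv x _ hx =>
    rw [isNormalElt_iff] at hx ⊢
    exact fun h hh => by simpa using (hx h hh).symm

/-- Normality survives products and inverses, so inside `q(N(H))` only membership in `H` remains to
be tested. -/
theorem mem_normalizingSubmonoid_iff_of_mem_closure {g : G}
    (hg : g ∈ Subgroup.closure (normalizingSubmonoid H : Set G)) :
    g ∈ normalizingSubmonoid H ↔ g ∈ H :=
  ⟨fun h => h.1, fun h => ⟨h, isNormalElt_of_mem_closure hg⟩⟩

theorem mem_inOwnGroup_iff
    {x : Subgroup.closure (normalizingSubmonoid H : Set G)} :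
    x ∈ inOwnGroup (normalizingSubmonoid H) ↔ (x : G) ∈ H :=
  mem_normalizingSubmonoid_iff_of_mem_closure x.2

theorem conj_mem {g : G} (hg : g ∈ Subgroup.closure (normalizingSubmonoid H : Set G)) {h : G}
    (hh : h ∈ H) : g * h * g⁻¹ ∈ H :=
  (isNormalElt_iff.1 (isNormalElt_of_mem_closure hg) h hh).1

theorem conj_mem' {g : G} (hg : g ∈ Subgroup.closure (normalizingSubmonoid H : Set G)) {h : G}
    (hh : h ∈ H) : g⁻¹ * h * g ∈ H :=
  (isNormalElt_iff.1 (isNormalElt_of_mem_closure hg) h hh).2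

theorem isNormalizing_inOwnGroup :
    IsNormalizing (inOwnGroup (normalizingSubmonoid H)) := fun a _ =>
  isNormalElt_iff.2 fun _ hh => ⟨mem_inOwnGroup_iff.2 (conj_mem a.2 (mem_inOwnGroup_iff.1 hh)),
    mem_inOwnGroup_iff.2 (conj_mem' a.2 (mem_inOwnGroup_iff.1 hh))⟩

theorem exists_eq_inv_mul_of_mem_closure {g : G}
    (hg : g ∈ Subgroup.closure (normalizingSubmonoid H : Set G)) :
    ∃ a ∈ normalizingSubmonoid H, ∃ b ∈ normalizingSubmonoid H, g = a⁻¹ * b := by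
  have hsub := Subgroup.subset_closure (k := (normalizingSubmonoid H : Set G))
  induction hg using Subgroup.closure_induction with
  | mem x hx => exact ⟨1, one_mem _, x, hx, by simp⟩
  | one => exact ⟨1, one_mem _, 1, one_mem _, by simp⟩
  | mul x y _ _ hx hy =>
    obtain ⟨a, ha, b, hb, rfl⟩ := hx
    obtain ⟨c, hc, d, hd, rfl⟩ := hy
    -- Conjugation by `c` moves `c⁻¹` past `b`: `a⁻¹ b c⁻¹ d = (ca)⁻¹ (c b c⁻¹) d`.
    refine ⟨c * a, mul_mem hc ha, c * b * c⁻¹ * d, mul_mem ?_ hd, by simp [mul_assoc]⟩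
    exact (mem_normalizingSubmonoid_iff_of_mem_closure (mul_mem (mul_mem (hsub hc) (hsub hb))
      (inv_mem (hsub hc)))).2 (conj_mem (hsub hc) hb.1)
  | inv x _ hx =>
    obtain ⟨a, ha, b, hb, rfl⟩ := hx
    exact ⟨b, hb, a, ha, by simp⟩

theorem isQuotientGroup_inOwnGroup :
    IsQuotientGroup (inOwnGroup (normalizingSubmonoid H)) := by
  have hsub := Subgroup.subset_closure (k := (normalizingSubmonoid H : Set G))
  have key : ∀ g : Subgroup.closure (normalizingSubmonoid H : Set G),
      ∃ a ∈ inOwnGroup (normalizingSubmonoid H), ∃ b ∈ inOwnGroup (normalizingSubmonoid H),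
        g = a⁻¹ * b := fun g => by
    obtain ⟨a, ha, b, hb, h⟩ := exists_eq_inv_mul_of_mem_closure g.2
    exact ⟨⟨a, hsub ha⟩, ha, ⟨b, hsub hb⟩, hb, Subtype.ext h⟩
  refine ⟨key, fun g => ?_⟩
  obtain ⟨a, ha, b, hb, rfl⟩ := key g
  exact ⟨a, ha, a⁻¹ * b * a, (isNormalElt_iff.1 (isNormalizing_inOwnGroup a ha) b hb).2, by simp⟩

/-- The extension `A H` of a subset `A` of `q(N(H))` to a subset of the quotient group of `H`. -/
def extend (H : Submonoid G) (A : Set (Subgroup.closure (normalizingSubmonoid H : Set G))) :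
    Set G := ((↑) '' A) * (H : Set G)

theorem mem_extend {A : Set (Subgroup.closure (normalizingSubmonoid H : Set G))}
    {a : Subgroup.closure (normalizingSubmonoid H : Set G)} (ha : a ∈ A) : (a : G) ∈ extend H A :=
  ⟨a, ⟨a, ha, rfl⟩, 1, H.one_mem, mul_one _⟩

/-- Left stability is `g a h = a (a⁻¹ g a) h`, as `a` normalises `H`. -/
theorem isIdeal_extend {A : Set (Subgroup.closure (normalizingSubmonoid H : Set G))}
    (hA : A ⊆ inOwnGroup (normalizingSubmonoid H)) : IsIdeal H (extend H A) := by
  refine isIdeal_of_subset ?_ ?_ ?_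
  · rintro g hg _ ⟨_, ⟨a, ha, rfl⟩, h, hh, rfl⟩
    exact ⟨a, ⟨a, ha, rfl⟩, _, H.mul_mem (conj_mem' a.2 hg) hh, by simp [mul_assoc]⟩
  · rintro _ ⟨_, ⟨a, ha, rfl⟩, h, hh, rfl⟩ g hg
    exact ⟨a, ⟨a, ha, rfl⟩, _, H.mul_mem hh hg, by simp [mul_assoc]⟩
  · rintro _ ⟨_, ⟨a, ha, rfl⟩, h, hh, rfl⟩
    exact H.mul_mem (mem_inOwnGroup_iff.1 (hA ha)) hh

theorem IsComplIntClosed.inOwnGroup (hc : IsComplIntClosed H) :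
    IsComplIntClosed (inOwnGroup (normalizingSubmonoid H)) := by
  intro A hA ⟨a₀, ha₀⟩
  have h1 := hc _ (isIdeal_extend hA.2) ⟨_, mem_extend ha₀⟩
  refine ⟨Set.Subset.antisymm (fun x hx => mem_inOwnGroup_iff.2 (h1.1.subset ?_))
    fun x hx a ha => hA.1.mul_mem_left hx ha,
    Set.Subset.antisymm (fun x hx => mem_inOwnGroup_iff.2 (h1.2.subset ?_))
    fun x hx a ha => hA.1.mul_mem_right ha hx⟩
  · rintro _ ⟨_, ⟨a, ha, rfl⟩, h, hh, rfl⟩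
    exact ⟨_, ⟨_, hx a ha, rfl⟩, h, hh, by simp [mul_assoc]⟩
  · rintro _ ⟨_, ⟨a, ha, rfl⟩, h, hh, rfl⟩
    exact ⟨_, ⟨_, hx a ha, rfl⟩, _, conj_mem' x.2 hh, by simp [mul_assoc]⟩

/-- The chain `(A_n H)_v` stabilises. If `A_n z ⊆ N(H)`, then `A_n H z = A_n z (z⁻¹ H z) ⊆ H`; so
every `y ∈ (A_n H)_v` in `q(N(H))` satisfies `yz ∈ H`, and `y ∈ A_n` by divisoriality. -/
theorem IsVNoetherian.inOwnGroup (hc : IsComplIntClosed H) (hv : IsVNoetherian H) :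
    IsVNoetherian (inOwnGroup (normalizingSubmonoid H)) := by
  intro A hA hmono
  have hdiv : ∀ n, vClosure H (extend H (A n)) ∈ divIdeals H := fun n => by
    have hI := isIdeal_extend (hA n).2.2
    have hd := vClosure_mem_divFrac hI.1 (hasVClosure_of_isComplIntClosed hc hI.1)
    exact ⟨hd, hd.1, fun x hx => by simpa using hx 1 fun b hb => by simpa using hI.2 hb⟩
  obtain ⟨n, hn⟩ := hv (fun n => vClosure H (extend H (A n))) hdiv fun i j hij =>
    leftClosure_mono (Set.mul_subset_mul_right (Set.image_mono (hmono hij)))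
  refine ⟨n, fun m hm => Set.Subset.antisymm (fun y hy => ?_) (hmono hm)⟩
  have h1 : (y : G) ∈ leftClosure H (extend H (A n)) :=
    (hn m hm).subset (subset_leftClosure _ (mem_extend hy))
  rw [(hA n).1.2.2]
  intro z hz
  refine mem_inOwnGroup_iff.2 (h1 z ?_)
  rintro _ ⟨_, ⟨a, ha, rfl⟩, h, hh, rfl⟩
  have h2 : (a : G) * z * ((z : G)⁻¹ * h * z) ∈ H :=
    H.mul_mem (mem_inOwnGroup_iff.1 (hz a ha)) (conj_mem' z.2 hh)
  simpa [mul_assoc] using h2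

/-- The normalizing submonoid of a Krull monoid is a Krull monoid. -/
theorem IsKrull.inOwnGroup (h : IsKrull H) : IsKrull (inOwnGroup (normalizingSubmonoid H)) :=
  ⟨isQuotientGroup_inOwnGroup, h.2.1.inOwnGroup, h.2.2.inOwnGroup h.2.1⟩

end KrullMonoid

namespace KrullMonoid

theorem IsFractionalIdeal.mul {G : Type*} [Group G] {H : Submonoid G} {A B : Set G}
    (hA : IsFractionalIdeal H A) (hB : IsFractionalIdeal H B) : IsFractionalIdeal H (A * B) := by
  refine ⟨by rw [← mul_assoc, hA.1], by rw [mul_assoc, hB.2.1], ?_, ?_⟩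
  · obtain ⟨a, ha, haA⟩ := hA.2.2.1
    obtain ⟨b, hb, hbB⟩ := hB.2.2.1
    refine ⟨b * a, H.mul_mem hb ha, ?_⟩
    rintro _ ⟨x, hx, y, hy, rfl⟩
    have h := haA _ (hA.mul_mem_right hx (hbB y hy))
    simpa only [mul_assoc] using h
  · obtain ⟨a, ha, haA⟩ := hA.2.2.2
    obtain ⟨b, hb, hbB⟩ := hB.2.2.2
    refine ⟨b * a, H.mul_mem hb ha, ?_⟩
    rintro _ ⟨x, hx, y, hy, rfl⟩
    have h := hbB _ (hB.mul_mem_left (haA x hx) hy)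
    simpa only [mul_assoc] using h

end KrullMonoid

/-! ### Transfer between `R` and `H` -/

namespace KrullRing

variable {Q : Type*} [Ring Q] {R : Subring Q}

theorem IsFractionalIdeal.isBimodule {A : AddSubgroup Q} (hA : IsFractionalIdeal R A) :
    IsBimodule R A := ⟨hA.1, hA.2.1⟩

theorem IsIdeal.isBimodule {A : AddSubgroup Q} (hA : IsIdeal R A) : IsBimodule R A :=
  ⟨hA.1, hA.2.1⟩

theorem isBimodule_toAddSubgroup : IsBimodule R R.toAddSubgroup :=
  ⟨fun _ hr _ hx => R.mul_mem hr hx, fun _ hr _ hx => R.mul_mem hx hr⟩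

theorem IsBimodule.leftQuot {A B : AddSubgroup Q} (hA : IsBimodule R A) (hB : IsBimodule R B) :
    IsBimodule R (leftQuot A B) :=
  ⟨fun r hr x hx b hb => by rw [mul_assoc]; exact hA.1 r hr _ (hx b hb),
    fun r hr x hx b hb => by rw [mul_assoc]; exact hx _ (hB.1 r hr b hb)⟩

theorem IsBimodule.rightQuot {A B : AddSubgroup Q} (hA : IsBimodule R A) (hB : IsBimodule R B) :
    IsBimodule R (rightQuot A B) :=
  ⟨fun r hr x hx b hb => by rw [← mul_assoc]; exact hx _ (hB.2 r hr b hb),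
    fun r hr x hx b hb => by rw [← mul_assoc]; exact hA.2 r hr _ (hx b hb)⟩

theorem IsBimodule.leftClosure {A : AddSubgroup Q} (hA : IsBimodule R A) :
    IsBimodule R (leftClosure R A) :=
  isBimodule_toAddSubgroup.leftQuot (isBimodule_toAddSubgroup.rightQuot hA)

theorem IsBimodule.rightClosure {A : AddSubgroup Q} (hA : IsBimodule R A) :
    IsBimodule R (rightClosure R A) :=
  isBimodule_toAddSubgroup.rightQuot (isBimodule_toAddSubgroup.leftQuot hA)

theorem reg_toAddSubgroup : reg R.toAddSubgroup = (regMonoid R : Set Qˣ) := rfl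

theorem reg_mono {A B : AddSubgroup Q} (h : A ≤ B) : reg A ⊆ reg B := fun _ hu => h hu

theorem addSpan_mono {X Y : Set Qˣ} (h : X ⊆ Y) : addSpan X ≤ addSpan Y :=
  addSpan_le.2 fun _ hu => mem_addSpan (h hu)

theorem reg_leftQuot_addSpan (A : AddSubgroup Q) (X : Set Qˣ) :
    reg (leftQuot A (addSpan X)) = KrullMonoid.leftQuot (reg A) X :=
  Set.Subset.antisymm (fun _ hu x hx => hu x (mem_addSpan hx)) fun _ hu _ hx =>
    mul_mem_of_mem_addSpan_right (fun v hv => hu v hv) hx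

theorem reg_rightQuot_addSpan (A : AddSubgroup Q) (X : Set Qˣ) :
    reg (rightQuot A (addSpan X)) = KrullMonoid.rightQuot (reg A) X :=
  Set.Subset.antisymm (fun _ hu x hx => hu x (mem_addSpan hx)) fun _ hu _ hx =>
    mul_mem_of_mem_addSpan_left (fun v hv => hu v hv) hx

theorem isFractionalIdeal_reg (hQ : IsClassicalQuotientRing R) {A : AddSubgroup Q}
    (hA : IsFractionalIdeal R A) : KrullMonoid.IsFractionalIdeal (regMonoid R) (reg A) := by
  refine ⟨KrullMonoid.coe_mul_eq_self fun g hg x hx => hA.1 _ hg _ hx,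
    KrullMonoid.mul_coe_eq_self fun x hx g hg => hA.2.1 _ hg _ hx, ?_, ?_⟩
  · obtain ⟨b, hb⟩ := hA.2.2.2
    -- The bound `b` is any unit of `Q`; a denominator moves it into `H`.
    obtain ⟨u, hu, hbu⟩ := exists_mul_units_mem hQ (b : Q)
    refine ⟨b * u, hbu, fun x hx => ?_⟩
    change ((x * (b * u) : Qˣ) : Q) ∈ R
    rw [← mul_assoc]
    exact R.mul_mem (hb x hx) hu
  · obtain ⟨b, hb⟩ := hA.2.2.1
    obtain ⟨u, hu, hbu⟩ := exists_units_mul_mem hQ (b : Q)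
    refine ⟨u * b, hbu, fun x hx => ?_⟩
    change ((u * b * x : Qˣ) : Q) ∈ R
    rw [mul_assoc]
    exact R.mul_mem hu (hb x hx)

theorem isQuotientGroup_regMonoid (hQ : IsClassicalQuotientRing R) :
    KrullMonoid.IsQuotientGroup (regMonoid R) := by
  refine ⟨fun g => ?_, fun g => ?_⟩
  · obtain ⟨u, hu, h⟩ := exists_units_mul_mem hQ (g : Q)
    exact ⟨u, hu, u * g, h, by simp⟩
  · obtain ⟨u, hu, h⟩ := exists_mul_units_mem hQ (g : Q)
    exact ⟨u, hu, g * u, h, by simp⟩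

theorem le_iff_reg_subset_reg (hR : IsPrimeGoldie R) (hQ : IsClassicalQuotientRing R)
    {A B : AddSubgroup Q} (hA : IsBimodule R A) : A ≤ B ↔ reg A ⊆ reg B := by
  rw [← addSpan_le, addSpan_reg hR hQ hA]

theorem reg_injOn (hR : IsPrimeGoldie R) (hQ : IsClassicalQuotientRing R)
    {A B : AddSubgroup Q} (hA : IsBimodule R A) (hB : IsBimodule R B) (h : reg A = reg B) :
    A = B := by
  rw [← addSpan_reg hR hQ hA, h, addSpan_reg hR hQ hB]

/-- `R` is itself additively generated by `H`, so stability under `H` implies stability under `R`.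
-/
theorem isBimodule_addSpan (hR : IsPrimeGoldie R) (hQ : IsClassicalQuotientRing R)
    {X : Set Qˣ} (hX : KrullMonoid.IsFractionalIdeal (regMonoid R) X) :
    IsBimodule R (addSpan X) := by
  have hRH : R.toAddSubgroup = addSpan (regMonoid R : Set Qˣ) :=
    (addSpan_reg hR hQ isBimodule_toAddSubgroup).symm
  refine ⟨fun r hr x hx => ?_, fun r hr x hx => ?_⟩
  · have hr : r ∈ addSpan (regMonoid R : Set Qˣ) := hRH ▸ hr
    refine mul_mem_of_mem_addSpan_left (fun u hu => mul_mem_of_mem_addSpan_right (fun v hv => ?_) hx) hr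
    exact mem_addSpan (u := u * v) (hX.mul_mem_left hu hv)
  · have hr : r ∈ addSpan (regMonoid R : Set Qˣ) := hRH ▸ hr
    refine mul_mem_of_mem_addSpan_right (fun u hu => mul_mem_of_mem_addSpan_left (fun v hv => ?_) hx) hr
    exact mem_addSpan (u := v * u) (hX.mul_mem_right hv hu)

theorem isFractionalIdeal_addSpan (hR : IsPrimeGoldie R) (hQ : IsClassicalQuotientRing R)
    {X : Set Qˣ} (hX : KrullMonoid.IsFractionalIdeal (regMonoid R) X) :
    IsFractionalIdeal R (addSpan X) := by
  obtain ⟨h1, h2⟩ := isBimodule_addSpan hR hQ hX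
  obtain ⟨a, -, ha⟩ := hX.2.2.1
  obtain ⟨b, -, hb⟩ := hX.2.2.2
  exact ⟨h1, h2, ⟨b, fun x hx => mul_mem_of_mem_addSpan_right (A := R.toAddSubgroup) hb hx⟩,
    ⟨a, fun x hx => mul_mem_of_mem_addSpan_left (A := R.toAddSubgroup) ha hx⟩⟩

theorem span_eq_addSpan (hR : IsPrimeGoldie R) (hQ : IsClassicalQuotientRing R)
    {X : Set Qˣ} (hX : KrullMonoid.IsFractionalIdeal (regMonoid R) X) :
    span R X = addSpan X := by
  refine le_antisymm ((AddSubgroup.closure_le _).2 ?_) (addSpan_le.2 fun x hx => ?_)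
  · rintro _ ⟨x, hx, r, hr, rfl⟩
    exact (isBimodule_addSpan hR hQ hX).2 r hr _ (mem_addSpan hx)
  · exact AddSubgroup.subset_closure ⟨x, hx, 1, R.one_mem, (mul_one _).symm⟩

/-- The inner quotient is a bimodule, hence spanned by its units, and both quotients can be tested
on generators. -/
theorem reg_leftClosure_addSpan (hR : IsPrimeGoldie R) (hQ : IsClassicalQuotientRing R)
    {X : Set Qˣ} (hX : KrullMonoid.IsFractionalIdeal (regMonoid R) X) :
    reg (leftClosure R (addSpan X)) = KrullMonoid.leftClosure (regMonoid R) X := by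
  have h := isBimodule_toAddSubgroup.rightQuot (isBimodule_addSpan hR hQ hX)
  rw [leftClosure, ← addSpan_reg hR hQ h, reg_rightQuot_addSpan, reg_leftQuot_addSpan]
  rfl

theorem reg_rightClosure_addSpan (hR : IsPrimeGoldie R) (hQ : IsClassicalQuotientRing R)
    {X : Set Qˣ} (hX : KrullMonoid.IsFractionalIdeal (regMonoid R) X) :
    reg (rightClosure R (addSpan X)) = KrullMonoid.rightClosure (regMonoid R) X := by
  have h := isBimodule_toAddSubgroup.leftQuot (isBimodule_addSpan hR hQ hX)
  rw [rightClosure, ← addSpan_reg hR hQ h, reg_leftQuot_addSpan, reg_rightQuot_addSpan]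
  rfl

theorem hasVClosure_addSpan_iff (hR : IsPrimeGoldie R) (hQ : IsClassicalQuotientRing R)
    {X : Set Qˣ} (hX : KrullMonoid.IsFractionalIdeal (regMonoid R) X) :
    HasVClosure R (addSpan X) ↔ KrullMonoid.HasVClosure (regMonoid R) X := by
  have h := isBimodule_addSpan hR hQ hX
  rw [HasVClosure, KrullMonoid.HasVClosure, ← reg_leftClosure_addSpan hR hQ hX,
    ← reg_rightClosure_addSpan hR hQ hX]
  exact ⟨congrArg reg, reg_injOn hR hQ h.leftClosure h.rightClosure⟩

theorem vClosure_addSpan (hR : IsPrimeGoldie R) (hQ : IsClassicalQuotientRing R)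
    {X : Set Qˣ} (hX : KrullMonoid.IsFractionalIdeal (regMonoid R) X) :
    vClosure R (addSpan X) = addSpan (KrullMonoid.vClosure (regMonoid R) X) := by
  rw [KrullMonoid.vClosure, ← reg_leftClosure_addSpan hR hQ hX,
    addSpan_reg hR hQ (isBimodule_addSpan hR hQ hX).leftClosure, vClosure]

theorem reg_mem_divFrac (hR : IsPrimeGoldie R) (hQ : IsClassicalQuotientRing R)
    {A : AddSubgroup Q} (hA : A ∈ divFrac R) : reg A ∈ KrullMonoid.divFrac (regMonoid R) := by
  have hX := isFractionalIdeal_reg hQ hA.1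
  have hspan := addSpan_reg hR hQ hA.1.isBimodule
  refine ⟨hX, (hasVClosure_addSpan_iff hR hQ hX).1 (hspan.symm ▸ hA.2.1), ?_⟩
  rw [KrullMonoid.vClosure, ← reg_leftClosure_addSpan hR hQ hX, hspan]
  exact congrArg reg hA.2.2

theorem addSpan_mem_divFrac (hR : IsPrimeGoldie R) (hQ : IsClassicalQuotientRing R)
    {X : Set Qˣ} (hX : X ∈ KrullMonoid.divFrac (regMonoid R)) : addSpan X ∈ divFrac R :=
  ⟨isFractionalIdeal_addSpan hR hQ hX.1, (hasVClosure_addSpan_iff hR hQ hX.1).2 hX.2.1, by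
    rw [vClosure_addSpan hR hQ hX.1, ← hX.2.2]⟩

/-- The span of `X` is its own closure, whose units form `X_v = X`: divisoriality excludes new
units. -/
theorem reg_addSpan (hR : IsPrimeGoldie R) (hQ : IsClassicalQuotientRing R)
    {X : Set Qˣ} (hX : X ∈ KrullMonoid.divFrac (regMonoid R)) : reg (addSpan X) = X := by
  rw [(addSpan_mem_divFrac hR hQ hX).2.2, vClosure, reg_leftClosure_addSpan hR hQ hX.1]
  exact hX.2.2.symm

theorem isIdeal_reg {A : AddSubgroup Q} (hA : IsIdeal R A) :
    KrullMonoid.IsIdeal (regMonoid R) (reg A) :=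
  KrullMonoid.isIdeal_of_subset (fun _ hg _ hx => hA.1 _ hg _ hx)
    (fun _ hx _ hg => hA.2.1 _ hg _ hx) (reg_mono hA.2.2)

theorem isIdeal_addSpan (hR : IsPrimeGoldie R) (hQ : IsClassicalQuotientRing R)
    {X : Set Qˣ} (hX : KrullMonoid.IsIdeal (regMonoid R) X) : IsIdeal R (addSpan X) :=
  ⟨(isBimodule_addSpan hR hQ hX.1).1, (isBimodule_addSpan hR hQ hX.1).2, addSpan_le.2 hX.2⟩

theorem isPrimeIdeal_reg (hR : IsPrimeGoldie R) (hQ : IsClassicalQuotientRing R)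
    {P : AddSubgroup Q} (hP : IsPrimeIdeal R P) :
    KrullMonoid.IsPrimeIdeal (regMonoid R) (reg P) := by
  refine ⟨isIdeal_reg hP.1, fun h => hP.2.1 ?_, fun X Y hX hY hXY => ?_⟩
  · exact reg_injOn hR hQ hP.1.isBimodule isBimodule_toAddSubgroup h
  · simp only [← addSpan_le]
    refine hP.2.2 _ _ (isIdeal_addSpan hR hQ hX) (isIdeal_addSpan hR hQ hY) ?_
    rwa [addSpan_mul_addSpan, addSpan_le]

theorem IsPrimeIdeal.of_reg (hR : IsPrimeGoldie R) (hQ : IsClassicalQuotientRing R)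
    {P : AddSubgroup Q} (hI : IsIdeal R P) (hP : KrullMonoid.IsPrimeIdeal (regMonoid R) (reg P)) :
    IsPrimeIdeal R P := by
  refine ⟨hI, fun h => hP.2.1 (by rw [h, reg_toAddSubgroup]), fun A B hA hB hAB => ?_⟩
  rw [le_iff_reg_subset_reg hR hQ hA.isBimodule, le_iff_reg_subset_reg hR hQ hB.isBimodule]
  refine hP.2.2 _ _ (isIdeal_reg hA) (isIdeal_reg hB) ?_
  rintro _ ⟨u, hu, v, hv, rfl⟩
  exact hAB (mul_mem_mul hu hv)

theorem isComplIntClosed_iff (hR : IsPrimeGoldie R) (hQ : IsClassicalQuotientRing R) :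
    IsComplIntClosed R ↔ KrullMonoid.IsComplIntClosed (regMonoid R) := by
  constructor
  · rintro h X hX ⟨x, hx⟩
    have hI := isIdeal_addSpan hR hQ hX
    have := hR.1.1
    have hx0 : (x : Q) ≠ 0 := fun h0 => one_ne_zero (α := R) (Subtype.ext (by
      rw [OneMemClass.coe_one, ← x.mul_inv, h0, zero_mul, ZeroMemClass.coe_zero]))
    obtain ⟨h1, h2⟩ := h _ hI fun h0 => hx0 ((AddSubgroup.mem_bot).1 (h0 ▸ mem_addSpan hx))
    refine ⟨Set.Subset.antisymm (fun y hy => h1.le ?_) fun y hy z hz => hX.1.mul_mem_left hy hz,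
      Set.Subset.antisymm (fun y hy => h2.le ?_) fun y hy z hz => hX.1.mul_mem_right hz hy⟩
    · exact fun z hz => mul_mem_of_mem_addSpan_right (fun v hv => mem_addSpan (hy v hv)) hz
    · exact fun z hz => mul_mem_of_mem_addSpan_left (fun v hv => mem_addSpan (hy v hv)) hz
  · intro h A hA hA0
    have hb := hA.isBimodule
    -- A non-zero ideal of `R` contains a unit of `Q`, so it gives a non-empty ideal of `H`.
    obtain ⟨h1, h2⟩ := h _ (isIdeal_reg hA) (exists_unit_mem hR hQ hb hA0)
    rw [← reg_leftQuot_addSpan, addSpan_reg hR hQ hb] at h1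
    rw [← reg_rightQuot_addSpan, addSpan_reg hR hQ hb] at h2
    exact ⟨reg_injOn hR hQ (hb.leftQuot hb) isBimodule_toAddSubgroup h1,
      reg_injOn hR hQ (hb.rightQuot hb) isBimodule_toAddSubgroup h2⟩

theorem isVNoetherian_iff (hR : IsPrimeGoldie R) (hQ : IsClassicalQuotientRing R) :
    IsVNoetherian R ↔ KrullMonoid.IsVNoetherian (regMonoid R) := by
  constructor
  · intro h X hX hmono
    obtain ⟨n, hn⟩ := h (fun n => addSpan (X n)) (fun n => ⟨addSpan_mem_divFrac hR hQ (hX n).1,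
      isIdeal_addSpan hR hQ (hX n).2⟩) fun i j hij => addSpan_mono (hmono hij)
    refine ⟨n, fun m hm => ?_⟩
    rw [← reg_addSpan hR hQ (hX m).1, ← reg_addSpan hR hQ (hX n).1]
    exact congrArg reg (hn m hm)
  · intro h A hA hmono
    obtain ⟨n, hn⟩ := h (fun n => reg (A n)) (fun n => ⟨reg_mem_divFrac hR hQ (hA n).1,
      isIdeal_reg (hA n).2⟩) fun i j hij => reg_mono (hmono hij)
    exact ⟨n, fun m hm => reg_injOn hR hQ (hA m).2.isBimodule (hA n).2.isBimodule (hn m hm)⟩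

end KrullRing

/-! ### The proposition -/

theorem proposition5p1 {Q : Type*} [Ring Q] (R : Subring Q)
    (hR : KrullRing.IsPrimeGoldie R) (hQ : KrullRing.IsClassicalQuotientRing R)
    (H : Submonoid Qˣ) (hH : H = KrullRing.regMonoid R) :
    -- Part 1: complete integral closedness
    (KrullRing.IsComplIntClosed R ↔ KrullMonoid.IsComplIntClosed H) ∧
    -- Part 2: mutually inverse inclusion preserving bijections of divisorial fractional ideals
    (Set.MapsTo KrullRing.reg (KrullRing.divFrac R) (KrullMonoid.divFrac H) ∧
      Set.MapsTo (KrullRing.span R) (KrullMonoid.divFrac H) (KrullRing.divFrac R) ∧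
      Set.InvOn (KrullRing.span R) KrullRing.reg (KrullRing.divFrac R) (KrullMonoid.divFrac H) ∧
      MonotoneOn KrullRing.reg (KrullRing.divFrac R) ∧
      MonotoneOn (KrullRing.span R) (KrullMonoid.divFrac H)) ∧
    -- they respect `v`-multiplication wherever it is defined
    (∀ A ∈ KrullRing.divFrac R, ∀ B ∈ KrullRing.divFrac R,
      (KrullRing.HasVClosure R (A * B) ↔
        KrullMonoid.HasVClosure H (KrullRing.reg A * KrullRing.reg B)) ∧
      (KrullRing.HasVClosure R (A * B) →
        KrullRing.vClosure R (A * B) ∈ KrullRing.divFrac R ∧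
        KrullRing.reg (KrullRing.vClosure R (A * B)) =
          KrullMonoid.vClosure H (KrullRing.reg A * KrullRing.reg B))) ∧
    (∀ A ∈ KrullMonoid.divFrac H, ∀ B ∈ KrullMonoid.divFrac H,
      KrullMonoid.HasVClosure H (A * B) →
        KrullMonoid.vClosure H (A * B) ∈ KrullMonoid.divFrac H ∧
        KrullRing.span R (KrullMonoid.vClosure H (A * B)) =
          KrullRing.vClosure R (KrullRing.span R A * KrullRing.span R B)) ∧
    -- in the completely integrally closed case it is defined everywhere
    (KrullRing.IsComplIntClosed R →
      (∀ A ∈ KrullRing.divFrac R, ∀ B ∈ KrullRing.divFrac R,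
        KrullRing.HasVClosure R (A * B)) ∧
      (∀ A ∈ KrullMonoid.divFrac H, ∀ B ∈ KrullMonoid.divFrac H,
        KrullMonoid.HasVClosure H (A * B))) ∧
    -- (a): divisorial ideals and divisorial prime ideals
    Set.BijOn KrullRing.reg (KrullRing.divIdeals R) (KrullMonoid.divIdeals H) ∧
    Set.BijOn KrullRing.reg (KrullRing.vSpec R) (KrullMonoid.vSpec H) ∧
    -- (b): the ascending chain conditions
    (KrullRing.IsVNoetherian R ↔ KrullMonoid.IsVNoetherian H) ∧
    -- Part 3: Krull rings and Krull monoids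
    (KrullRing.IsKrull R ↔ KrullMonoid.IsKrull H) ∧
    (KrullMonoid.IsKrull H →
      KrullMonoid.IsNormalizing (KrullMonoid.inOwnGroup (KrullMonoid.normalizingSubmonoid H)) ∧
      KrullMonoid.IsKrull (KrullMonoid.inOwnGroup (KrullMonoid.normalizingSubmonoid H))) := by
  subst hH
  -- Products of bimodules are spanned by products of units, so `v`-products too reduce to closures
  -- of spans.
  have hmul : ∀ A ∈ KrullRing.divFrac R, ∀ B ∈ KrullRing.divFrac R,
      A * B = KrullRing.addSpan (KrullRing.reg A * KrullRing.reg B) := fun A hA B hB => by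
    rw [← KrullRing.addSpan_mul_addSpan, KrullRing.addSpan_reg hR hQ hA.1.isBimodule,
      KrullRing.addSpan_reg hR hQ hB.1.isBimodule]
  have hfrac : ∀ A ∈ KrullRing.divFrac R, ∀ B ∈ KrullRing.divFrac R,
      KrullMonoid.IsFractionalIdeal (KrullRing.regMonoid R) (KrullRing.reg A * KrullRing.reg B) :=
    fun A hA B hB =>
      (KrullRing.isFractionalIdeal_reg hQ hA.1).mul (KrullRing.isFractionalIdeal_reg hQ hB.1)
  have hV : ∀ A ∈ KrullRing.divFrac R, ∀ B ∈ KrullRing.divFrac R,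
      (KrullRing.HasVClosure R (A * B) ↔ KrullMonoid.HasVClosure (KrullRing.regMonoid R)
        (KrullRing.reg A * KrullRing.reg B)) := fun A hA B hB => by
    rw [hmul A hA B hB]
    exact KrullRing.hasVClosure_addSpan_iff hR hQ (hfrac A hA B hB)
  have hspan : ∀ X ∈ KrullMonoid.divFrac (KrullRing.regMonoid R),
      KrullRing.span R X = KrullRing.addSpan X := fun X hX =>
    KrullRing.span_eq_addSpan hR hQ hX.1
  have hmaps : Set.MapsTo (KrullRing.span R) (KrullMonoid.divFrac (KrullRing.regMonoid R))
      (KrullRing.divFrac R) := fun X hX => by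
    rw [hspan X hX]
    exact KrullRing.addSpan_mem_divFrac hR hQ hX
  have hmapsI : Set.MapsTo (KrullRing.span R) (KrullMonoid.divIdeals (KrullRing.regMonoid R))
      (KrullRing.divIdeals R) := fun X hX => by
    refine ⟨hmaps hX.1, ?_⟩
    rw [hspan X hX.1]
    exact KrullRing.isIdeal_addSpan hR hQ hX.2
  have hinv : Set.InvOn (KrullRing.span R) KrullRing.reg (KrullRing.divFrac R)
      (KrullMonoid.divFrac (KrullRing.regMonoid R)) := by
    refine ⟨fun A hA => ?_, fun X hX => ?_⟩
    · rw [hspan _ (KrullRing.reg_mem_divFrac hR hQ hA), KrullRing.addSpan_reg hR hQ hA.1.isBimodule]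
    · rw [hspan X hX, KrullRing.reg_addSpan hR hQ hX]
  have hCIC := KrullRing.isComplIntClosed_iff hR hQ
  have hACC := KrullRing.isVNoetherian_iff hR hQ
  refine ⟨hCIC, ⟨fun A hA => KrullRing.reg_mem_divFrac hR hQ hA, hmaps, hinv,
    fun A _ B _ h => KrullRing.reg_mono h, fun X hX Y hY h => ?_⟩,
    fun A hA B hB => ⟨hV A hA B hB, fun h => ?_⟩, fun X hX Y hY h => ?_, fun h => ⟨?_, ?_⟩,
    ?_, ?_, hACC, ?_, fun h => ⟨KrullMonoid.isNormalizing_inOwnGroup, h.inOwnGroup⟩⟩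
  · rw [hspan X hX, hspan Y hY]
    exact KrullRing.addSpan_mono h
  · have hX := hfrac A hA B hB
    have hXd := KrullMonoid.vClosure_mem_divFrac hX ((hV A hA B hB).1 h)
    rw [hmul A hA B hB, KrullRing.vClosure_addSpan hR hQ hX]
    exact ⟨KrullRing.addSpan_mem_divFrac hR hQ hXd, KrullRing.reg_addSpan hR hQ hXd⟩
  · have hXY := hX.1.mul hY.1
    have hd := KrullMonoid.vClosure_mem_divFrac hXY h
    refine ⟨hd, ?_⟩
    rw [hspan _ hd, hspan X hX, hspan Y hY, KrullRing.addSpan_mul_addSpan,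
      KrullRing.vClosure_addSpan hR hQ hXY]
  · exact fun A hA B hB => (hV A hA B hB).2
      (KrullMonoid.hasVClosure_of_isComplIntClosed (hCIC.1 h) (hfrac A hA B hB))
  · exact fun X hX Y hY =>
      KrullMonoid.hasVClosure_of_isComplIntClosed (hCIC.1 h) (hX.1.mul hY.1)
  · exact (hinv.mono (fun A hA => hA.1) fun X hX => hX.1).bijOn
      (fun A hA => ⟨KrullRing.reg_mem_divFrac hR hQ hA.1, KrullRing.isIdeal_reg hA.2⟩) hmapsI
  · refine (hinv.mono (fun A hA => hA.2.1) fun X hX => hX.2.1).bijOn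
      (fun A hA => ⟨KrullRing.isPrimeIdeal_reg hR hQ hA.1,
        KrullRing.reg_mem_divFrac hR hQ hA.2.1, KrullRing.isIdeal_reg hA.2.2⟩) fun X hX => ?_
    refine ⟨KrullRing.IsPrimeIdeal.of_reg hR hQ (hmapsI hX.2).2 ?_, hmapsI hX.2⟩
    rw [hinv.2 hX.2.1]
    exact hX.1
  · exact ⟨fun h => ⟨KrullRing.isQuotientGroup_regMonoid hQ, hCIC.1 h.2.1, hACC.1 h.2.2⟩,
      fun h => ⟨hR, hCIC.2 h.2.1, hACC.2 h.2.2⟩⟩
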